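/- **Characterisation of encodings of semisimple algebras.** Let $\mathcal A\cong\bigoplus_{j=1}^{l} M_{n_j}(\mathbb C)$ and $\mathcal B\cong\bigoplus_{i=1}^{k} M_{m_i}(\mathbb C)$ be finite-dimensional $C^*$-algebras with fixed $*$-isomorphic decompositions, all $n_j,m_i\ge 1$. A special JB algebra $A\subseteq\mathcal A$ is a real linear subspace of self-adjoint elements that contains $1$ and is closed under $a\circ b=\tfrac12(ab+ba)$, with the norm of $\mathcal A$; similarly $B\subseteq\mathcal B$. An encoding $\gamma:A\to B$ is a map with $\mathrm{spec}(\gamma(a))=\mathrm{spec}(a)$ and $\gamma(ta_1+(1-t)a_2)=t\gamma(a_1)+(1-t)\gamma(a_2)$ for all $a,a_1,a_2\in A$, $t\in[0,1]$. For $p_{ij},q_{ij}\in\mathbb N_0$ say that a map $\Gamma:\mathcal A\to\mathcal B$ *has multiplicities* $(p_{ij},q_{ij})$ if there are unitaries $U_i\in M_{m_i}(\mathbb C)$ such that for all $\alpha=(\alpha_1,\dots,\alpha_l)\in\mathcal A$ and all $i$ the $i$-th component of $\Gamma(\alpha)$ is $$\Gamma(\alpha)_i=U_i\Big(\bigoplus_{j}\big(\alpha_j^{\oplus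 p_{ij}}\oplus\bar\alpha_j^{\oplus q_{ij}}\big)\Big)U_i^\dagger ,$$ where $\bar\alpha_j$ is the entrywise complex conjugate. 1. Let $\gamma:A\to B$ be an encoding. Every unital $*$-preserving ring homomorphism $\Gamma:\mathcal A\to\mathcal B$ that extends $\gamma$ has multiplicities $(p_{ij},q_{ij})$ for some $p_{ij},q_{ij}\in\mathbb N_0$ with $\sum_j(p_{ij}+q_{ij})\,n_j=m_i$ for every $i$. If $A$ is the set of all self-adjoint elements of $\mathcal A$, then moreover for every $j$ there is an $i$ with $p_{ij}+q_{ij}>0$. 2. Let $\gamma:A\to B$ be an encoding, where $A$ is the set of all self-adjoint elements of $\mathcal A$. Then $\gamma$ extends to a unital $*$-preserving ring homomorphism $\mathcal A\to\mathcal B$. Any unital ring homomorphism extending $\gamma$ that preserves $*$ on the summands with $n_j=1$ preserves $*$ everywhere. If all $n_j\ge2$, then $\gamma$ has exactly one extension to a unital ring homomorphism $\mathcal A\to\mathcal B$. 3. Conversely, let $p_{ij},q_{ij}\in\mathbb N_0$ satisfy $\sum_j(p_{ij}+q_{ij})n_j=m_i$ for every $i$, and suppose that for every $j$ there is an $i$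 with $p_{ij}+q_{ij}>0$. Then there is a map $\mathcal A\to\mathcal B$ with multiplicities $(p_{ij},q_{ij})$, and every such map is a unital $*$-preserving ring homomorphism whose restriction to the self-adjoint elements of $\mathcal A$ is an encoding into the self-adjoint elements of $\mathcal B$. So different summands (superselection sectors) may be embedded with different multiplicities. -/

import Mathlib

open scoped Matrix

/-- A special JB algebra, realised inside a C*-algebra `𝒜`: a real linear subspace of self-adjoint
elements which contains the unit and is closed under the Jordan product
`a ∘ b = (a b + b a) / 2`. It carries the norm of `𝒜`; see `SpecialJBAlgebra.norm_axioms`. -/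
structure SpecialJBAlgebra (𝒜 : Type*) [CStarAlgebra 𝒜] extends Submodule ℝ 𝒜 where
  one_mem' : (1 : 𝒜) ∈ carrier
  jordan_mem' : ∀ {a b : 𝒜}, a ∈ carrier → b ∈ carrier →
    (1 / 2 : ℝ) • (a * b + b * a) ∈ carrier
  isSelfAdjoint' : ∀ {a : 𝒜}, a ∈ carrier → IsSelfAdjoint a

namespace SpecialJBAlgebra

/-- The elements of a special JB algebra, as a type. -/
abbrev Elt {𝒜 : Type*} [CStarAlgebra 𝒜] (A : SpecialJBAlgebra 𝒜) : Type _ := A.toSubmodule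

/-- The special JB algebra of all self-adjoint elements of a C*-algebra. -/
def full (𝒜 : Type*) [CStarAlgebra 𝒜] : SpecialJBAlgebra 𝒜 where
  carrier := {a | IsSelfAdjoint a}
  add_mem' := fun ha hb => IsSelfAdjoint.add ha hb
  zero_mem' := IsSelfAdjoint.zero 𝒜
  smul_mem' := fun c _ ha => IsSelfAdjoint.smul (IsSelfAdjoint.all c) ha
  one_mem' := IsSelfAdjoint.one 𝒜
  jordan_mem' := by
    intro a b ha hb
    refine IsSelfAdjoint.smul (IsSelfAdjoint.all _) ?_
    have ha' : star a = a := ha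
    have hb' : star b = b := hb
    change star (a * b + b * a) = a * b + b * a
    rw [star_add, star_mul, star_mul, ha', hb', add_comm]
  isSelfAdjoint' := fun ha => ha

/-- The inherited norm satisfies the three JB axioms. -/
theorem norm_axioms {𝒜 : Type*} [CStarAlgebra 𝒜] (A : SpecialJBAlgebra 𝒜) (a b : A.Elt) :
    ‖(1 / 2 : ℝ) • ((a : 𝒜) * b + b * a)‖ ≤ ‖(a : 𝒜)‖ * ‖(b : 𝒜)‖ ∧
    ‖(a : 𝒜) ^ 2‖ = ‖(a : 𝒜)‖ ^ 2 ∧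
    ‖(a : 𝒜) ^ 2‖ ≤ ‖(a : 𝒜) ^ 2 + (b : 𝒜) ^ 2‖ := by
  have ha : IsSelfAdjoint (a : 𝒜) := A.isSelfAdjoint' a.2
  have hb : IsSelfAdjoint (b : 𝒜) := A.isSelfAdjoint' b.2
  refine ⟨?_, ?_, ?_⟩
  · rw [norm_smul]
    have h1 := norm_add_le ((a : 𝒜) * b) (b * a)
    have h2 := norm_mul_le (a : 𝒜) b
    have h3 := norm_mul_le (b : 𝒜) a
    norm_num
    nlinarith
  · rw [sq, sq, IsSelfAdjoint.norm_mul_self ha, sq]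
  · let _ := CStarAlgebra.spectralOrder 𝒜
    let _ := CStarAlgebra.spectralOrderedRing 𝒜
    refine CStarAlgebra.norm_le_norm_of_nonneg_of_le ?_ ?_
    · exact ha.sq_nonneg
    · exact le_add_of_nonneg_right hb.sq_nonneg

end SpecialJBAlgebra

/-- An encoding between special JB algebras: a map that preserves spectra and convex
combinations. -/
structure IsEncoding {𝒜 ℬ : Type*} [CStarAlgebra 𝒜] [CStarAlgebra ℬ]
    {A : SpecialJBAlgebra 𝒜} {B : SpecialJBAlgebra ℬ} (γ : A.Elt → B.Elt) : Prop where
  spectrum_eq : ∀ a : A.Elt, spectrum ℂ (γ a : ℬ) = spectrum ℂ (a : 𝒜)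
  convex : ∀ (a₁ a₂ : A.Elt) (t : ℝ), 0 ≤ t → t ≤ 1 →
    γ (t • a₁ + (1 - t) • a₂) = t • γ a₁ + (1 - t) • γ a₂

/-- The direct sum of full matrix algebras `M_{n 0}(ℂ) ⊕ ⋯ ⊕ M_{n (l-1)}(ℂ)`. -/
abbrev MatrixSum {l : ℕ} (n : Fin l → ℕ) : Type :=
  ∀ j : Fin l, Matrix (Fin (n j)) (Fin (n j)) ℂ

/-- Index set of the matrix `⊕ⱼ (αⱼ^{⊕ pⱼ} ⊕ ᾱⱼ^{⊕ qⱼ})`. -/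
abbrev CopyIndex {l : ℕ} (n p q : Fin l → ℕ) : Type :=
  Σ j : Fin l, (Fin (n j) × Fin (p j)) ⊕ (Fin (n j) × Fin (q j))

/-- The block diagonal matrix `⊕ⱼ (αⱼ^{⊕ pⱼ} ⊕ ᾱⱼ^{⊕ qⱼ})`, where the bar is entrywise complex
conjugation. -/
noncomputable def copies {l : ℕ} {n : Fin l → ℕ} (p q : Fin l → ℕ) (α : MatrixSum n) :
    Matrix (CopyIndex n p q) (CopyIndex n p q) ℂ :=
  Matrix.blockDiagonal' fun j =>
    Matrix.fromBlocks
      (Matrix.blockDiagonal fun _ : Fin (p j) => α j) 0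
      0 (Matrix.blockDiagonal fun _ : Fin (q j) => (α j).map (starRingEnd ℂ))

/-- With respect to decompositions `Φ` of `𝒜` and `Ψ` of `ℬ`, the `i`-th component of `Γ α` is,
up to a unitary `U i` (and a numbering `e i` of the basis), `⊕ⱼ (αⱼ^{⊕ p i j} ⊕ ᾱⱼ^{⊕ q i j})`. -/
def HasCopiesForm {𝒜 ℬ : Type*} [CStarAlgebra 𝒜] [CStarAlgebra ℬ]
    {l k : ℕ} {n : Fin l → ℕ} {m : Fin k → ℕ}
    (Φ : 𝒜 ≃⋆ₐ[ℂ] MatrixSum n) (Ψ : ℬ ≃⋆ₐ[ℂ] MatrixSum m)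
    (p q : Fin k → Fin l → ℕ) (Γ : 𝒜 → ℬ) : Prop :=
  ∃ (e : ∀ i : Fin k, CopyIndex n (p i) (q i) ≃ Fin (m i))
    (U : ∀ i : Fin k, Matrix (Fin (m i)) (Fin (m i)) ℂ),
    (∀ i, U i ∈ Matrix.unitaryGroup (Fin (m i)) ℂ) ∧
    ∀ (α : 𝒜) (i : Fin k),
      Ψ (Γ α) i =
        U i * Matrix.reindex (e i) (e i) (copies (p i) (q i) (Φ α)) * (U i)ᴴ

/-! An encoding fixes 0 and 1, because a self-adjoint element with spectrum {0} or {1} is that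
scalar; being affine, it is then real linear. Projections are the self-adjoint elements with
spectrum in {0, 1}, so they go to projections. Orthogonality of two projections is preserved because
their sum is a projection. On the full self-adjoint part the spectral decomposition gives γ(a²) =
γ(a)², and complexification gives a Jordan `*`-homomorphism θ (`IsEncoding.exists_jordanHom`).

On a matrix block of size at least 2, θ splits into a homomorphism plus an antihomomorphism that
annihilate each other (`IsJordanStarHom.eq_unitSum_add`). Replacing the transpose by entrywise
conjugation in the second summand makes it multiplicative and changes nothing on self-adjoint
matrices. This gives the extension Γ. It is unique because self-adjoint matrices of size at least 2
generate the whole matrix ring, including i·1 (`MatrixSum.subring_eq_top`).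

For the normal form, J = Γ(i·1) commutes with the image of Γ and J² = -1. So (1 ∓ iJ)/2 are
projections cutting Γ into a complex linear and a conjugate linear part. Each part carries matrix
units, and these permute a suitable orthonormal basis (`exists_eq_copiesHom`). Conversely, when
every summand occurs the formula is injective, and an injective real linear `*`-homomorphism
preserves spectra of self-adjoint elements. -/

namespace IsEncoding

/-! ### Real linearity of encodings and preservation of projections -/

section

variable {𝒜 ℬ : Type*} [CStarAlgebra 𝒜] [CStarAlgebra ℬ]
  {A : SpecialJBAlgebra 𝒜} {B : SpecialJBAlgebra ℬ} {γ : A.Elt → B.Elt}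

theorem spectrum_real_eq (h : IsEncoding γ) (a : A.Elt) :
    spectrum ℝ (γ a : ℬ) = spectrum ℝ (a : 𝒜) := by
  rw [← spectrum.preimage_algebraMap (R := ℝ) ℂ (a := (a : 𝒜)),
    ← spectrum.preimage_algebraMap (R := ℝ) ℂ (a := (γ a : ℬ)), h.spectrum_eq]

theorem map_zero (h : IsEncoding γ) : γ 0 = 0 := by
  apply Subtype.ext
  apply CFC.eq_zero_of_spectrum_subset_zero (R := ℝ) _ ?_ (B.isSelfAdjoint' (γ 0).2)
  rw [h.spectrum_real_eq]
  intro x hx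
  by_contra hne
  apply hx
  simpa [spectrum.mem_resolventSet_iff] using (IsUnit.mk0 x hne).map (algebraMap ℝ 𝒜)

theorem map_one (h : IsEncoding γ) (a : A.Elt) (ha : (a : 𝒜) = 1) : (γ a : ℬ) = 1 := by
  apply CFC.eq_one_of_spectrum_subset_one (R := ℝ) _ ?_ (B.isSelfAdjoint' (γ a).2)
  rw [h.spectrum_real_eq, ha]
  intro x hx
  by_contra hne
  apply hx
  have : (algebraMap ℝ 𝒜 x - 1) = algebraMap ℝ 𝒜 (x - 1) := by simp
  rw [spectrum.mem_resolventSet_iff, this]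
  exact (IsUnit.mk0 (x - 1) (sub_ne_zero.2 hne)).map (algebraMap ℝ 𝒜)

theorem map_smul_of_le_one (h : IsEncoding γ) (t : ℝ) (h0 : 0 ≤ t) (h1 : t ≤ 1) (a : A.Elt) :
    γ (t • a) = t • γ a := by
  simpa [h.map_zero] using h.convex a 0 t h0 h1

theorem map_smul_of_nonneg (h : IsEncoding γ) (t : ℝ) (h0 : 0 ≤ t) (a : A.Elt) :
    γ (t • a) = t • γ a := by
  rcases le_total t 1 with h1 | h1
  · exact h.map_smul_of_le_one t h0 h1 a
  -- For t ≥ 1, contract t • a by t⁻¹ ≤ 1.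
  · have ht : t ≠ 0 := by positivity
    have := h.map_smul_of_le_one t⁻¹ (by positivity) (inv_le_one_of_one_le₀ h1) (t • a)
    rw [inv_smul_smul₀ ht] at this
    rw [this, smul_inv_smul₀ ht]

/-- The sum is the midpoint of 2a and 2b. -/
theorem map_add (h : IsEncoding γ) (a b : A.Elt) : γ (a + b) = γ a + γ b := by
  have := h.convex ((2 : ℝ) • a) ((2 : ℝ) • b) (1 / 2) (by norm_num) (by norm_num)
  rw [h.map_smul_of_nonneg 2 (by norm_num), h.map_smul_of_nonneg 2 (by norm_num)] at this
  simpa [smul_smul, show (1 - 2⁻¹ : ℝ) * 2 = 1 by norm_num] using this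

theorem map_smul (h : IsEncoding γ) (t : ℝ) (a : A.Elt) : γ (t • a) = t • γ a := by
  rcases le_total 0 t with h0 | h0
  · exact h.map_smul_of_nonneg t h0 a
  · have := h.map_add (t • a) ((-t) • a)
    rw [← add_smul, h.map_smul_of_nonneg (-t) (by linarith)] at this
    simp only [add_neg_cancel, zero_smul, h.map_zero, neg_smul] at this
    exact (sub_eq_zero.1 (by rw [sub_eq_add_neg]; exact this.symm))

/-- An encoding as a real linear map. -/
def toLinearMap (h : IsEncoding γ) : A.Elt →ₗ[ℝ] ℬ where
  toFun a := γ a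
  map_add' a b := by rw [h.map_add]; rfl
  map_smul' t a := by rw [h.map_smul]; rfl

/-- Among self-adjoint elements, idempotents are recognised by their spectrum lying in {0, 1}. -/
theorem map_isIdempotentElem (h : IsEncoding γ) {a : A.Elt} (ha : IsIdempotentElem (a : 𝒜)) :
    IsIdempotentElem (γ a : ℬ) := by
  have h1 := (isStarProjection_iff_spectrum_subset_and_isSelfAdjoint (p := (a : 𝒜))).1
    ⟨ha, A.isSelfAdjoint' a.2⟩
  exact (isStarProjection_iff_spectrum_subset_and_isSelfAdjoint (p := (γ a : ℬ))).2
    ⟨by rw [h.spectrum_real_eq]; exact h1.1, B.isSelfAdjoint' (γ a).2⟩ |>.1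

end

end IsEncoding

/-! ### Orthogonal idempotents and finite spectral decomposition -/

/-- An idempotent anticommutes with an element only if they annihilate each other. -/
theorem IsIdempotentElem.annihilate_of_anticommute {R : Type*} [Ring R] [Algebra ℂ R] {p q : R}
    (hp : IsIdempotentElem p) (h0 : p * q + q * p = 0) : p * q = 0 ∧ q * p = 0 := by
  have hp' : p * p = p := hp
  -- Multiplying by p on either side shows that pq and qp both equal -pqp; hence pq = qp and 2pq =
  -- 0.
  have h1 : p * q + p * q * p = 0 := by
    have := congrArg (p * ·) h0
    simpa [mul_add, ← mul_assoc, hp'] using this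
  have h2 : p * q * p + q * p = 0 := by
    have := congrArg (· * p) h0
    simpa [add_mul, mul_assoc, hp'] using this
  have h3 : p * q = q * p := by
    have : p * q - q * p = (p * q + p * q * p) - (p * q * p + q * p) := by abel
    rw [h1, h2, sub_zero] at this
    exact sub_eq_zero.1 this
  rw [← h3, ← two_smul ℂ] at h0
  have h4 := (smul_eq_zero.1 h0).resolve_left two_ne_zero
  exact ⟨h4, h3 ▸ h4⟩

/-- If `p`, `q` and `p + q` are idempotent, then `p` and `q` are orthogonal. -/
theorem IsIdempotentElem.mul_eq_zero_of_add {R : Type*} [Ring R] [Algebra ℂ R] {p q : R}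
    (hp : IsIdempotentElem p) (hq : IsIdempotentElem q) (hpq : IsIdempotentElem (p + q)) :
    p * q = 0 := by
  refine (hp.annihilate_of_anticommute ?_).1
  have h : (p + q) * (p + q) = p + q := hpq
  rw [add_mul, mul_add, mul_add, hp.eq, hq.eq] at h
  have : p * q + q * p = (p + p * q + (q * p + q)) - (p + q) := by abel
  rw [this, h, sub_self]

/-- By spectral mapping, every spectral value is a root of the minimal polynomial. -/
theorem spectrum.finite_of_finiteDimensional (𝕜 : Type*) {R : Type*} [Field 𝕜] [Ring R]
    [Algebra 𝕜 R] [FiniteDimensional 𝕜 R] (a : R) : (spectrum 𝕜 a).Finite := by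
  classical
  have hi : IsIntegral 𝕜 a := Algebra.IsIntegral.isIntegral a
  have hp : minpoly 𝕜 a ≠ 0 := minpoly.ne_zero hi
  refine (minpoly 𝕜 a).roots.toFinset.finite_toSet.subset fun x hx => ?_
  have h := spectrum.subset_polynomial_aeval a (minpoly 𝕜 a) ⟨x, hx, rfl⟩
  rw [minpoly.aeval] at h
  simp only [Finset.mem_coe, Multiset.mem_toFinset, Polynomial.mem_roots hp, Polynomial.IsRoot]
  by_contra hne
  apply h
  simpa [spectrum.mem_resolventSet_iff] using (IsUnit.mk0 _ hne).map (algebraMap 𝕜 R)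

/-- The finite spectral decomposition of a self-adjoint element. -/
theorem IsSelfAdjoint.exists_spectral_sum {𝒜 : Type*} [CStarAlgebra 𝒜] [FiniteDimensional ℂ 𝒜]
    {a : 𝒜} (ha : IsSelfAdjoint a) :
    ∃ (s : Finset ℝ) (p : ℝ → 𝒜), (∀ x, IsStarProjection (p x)) ∧
      (∀ x y, x ≠ y → p x * p y = 0) ∧ a = ∑ x ∈ s, x • p x := by
  classical
  have : FiniteDimensional ℝ 𝒜 := FiniteDimensional.complexToReal 𝒜
  have hf := spectrum.finite_of_finiteDimensional ℝ a
  -- On a finite spectrum every function is continuous, so indicators of points may be used as the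
  -- spectral projections.
  have hc : ∀ f : ℝ → ℝ, ContinuousOn f (spectrum ℝ a) := fun f => hf.continuousOn f
  refine ⟨hf.toFinset, fun x => cfc (fun y => if y = x then 1 else 0 : ℝ → ℝ) a,
    fun x => ⟨?_, cfc_predicate _ a⟩, fun x y hxy => ?_, ?_⟩
  · rw [IsIdempotentElem, ← cfc_mul _ _ a (hc _) (hc _)]
    congr 1; ext y; simp
  · rw [← cfc_mul _ _ a (hc _) (hc _)]
    rw [← cfc_zero ℝ a]
    congr 1; ext z
    by_cases h : z = x
    · subst h; simp [hxy]
    · simp [h]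
  · have : ∀ x ∈ hf.toFinset, x • cfc (fun y => if y = x then 1 else 0 : ℝ → ℝ) a
        = cfc (fun y => x • (if y = x then 1 else 0) : ℝ → ℝ) a := fun x _ =>
      (cfc_smul x _ a (hc _)).symm
    rw [Finset.sum_congr rfl this, ← cfc_sum _ a _ (fun i _ => hc _)]
    conv_lhs => rw [← cfc_id ℝ a]
    refine cfc_congr fun x hx => ?_
    simp [hx]

theorem Finset.sum_smul_mul_self_of_orthogonal {R ι : Type*} [Ring R] [Algebra ℝ R]
    (s : Finset ι) (c : ι → ℝ) (q : ι → R) (h1 : ∀ x, q x * q x = q x)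
    (h2 : ∀ x y, x ≠ y → q x * q y = 0) :
    (∑ x ∈ s, c x • q x) * (∑ x ∈ s, c x • q x) = ∑ x ∈ s, (c x * c x) • q x := by
  classical
  rw [Finset.sum_mul_sum]
  refine Finset.sum_congr rfl fun x hx => ?_
  rw [Finset.sum_eq_single x]
  · rw [smul_mul_smul_comm, h1]
  · intro y _ hy; rw [smul_mul_smul_comm, h2 _ _ hy.symm, smul_zero]
  · exact fun hx' => (hx' hx).elim

/-! ### From encodings to Jordan `*`-homomorphisms -/

/-- A real linear map on the self-adjoint elements extends to a complex linear map. -/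
theorem selfAdjoint.exists_complexLinear_extension {𝒜 ℬ : Type*} [CStarAlgebra 𝒜]
    [CStarAlgebra ℬ] (g : selfAdjoint 𝒜 →ₗ[ℝ] ℬ) :
    ∃ θ : 𝒜 →ₗ[ℂ] ℬ, ∀ a : selfAdjoint 𝒜, θ a = g a := by
  refine ⟨
    { toFun := fun x => g (realPart x) + Complex.I • g (imaginaryPart x)
      map_add' := fun x y => by
        simp only [map_add, smul_add]; abel
      map_smul' := fun c x => ?_ }, fun a => ?_⟩
  · simp only [realPart_smul, imaginaryPart_smul, map_add, map_sub, map_smul, RingHom.id_apply,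
      ← Complex.coe_smul]
    match_scalars <;> apply Complex.ext <;> simp
  · simp

namespace IsEncoding

variable {𝒜 ℬ : Type*} [CStarAlgebra 𝒜] [CStarAlgebra ℬ] [FiniteDimensional ℂ 𝒜]
  {B : SpecialJBAlgebra ℬ} {γ : (SpecialJBAlgebra.full 𝒜).Elt → B.Elt}

/-- If a = ∑ x pₓ is the spectral decomposition, the images of the pₓ are again pairwise orthogonal
projections, so both squares are ∑ x² γ(pₓ). -/
theorem map_mul_self (h : IsEncoding γ) {a c : (SpecialJBAlgebra.full 𝒜).Elt}
    (hc : (c : 𝒜) = a * a) : (γ c : ℬ) = γ a * γ a := by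
  obtain ⟨s, p, hp, hpq, hs⟩ := IsSelfAdjoint.exists_spectral_sum (a := (a : 𝒜)) a.2
  let P : ℝ → (SpecialJBAlgebra.full 𝒜).Elt := fun x => ⟨p x, (hp x).2⟩
  have hP : ∀ x, IsIdempotentElem (γ (P x) : ℬ) := fun x => h.map_isIdempotentElem (hp x).1
  have hPQ : ∀ x y, x ≠ y → (γ (P x) : ℬ) * γ (P y) = 0 := fun x y hxy => by
    refine IsIdempotentElem.mul_eq_zero_of_add (hP x) (hP y) ?_
    have := h.map_isIdempotentElem (a := P x + P y) ?_
    · rw [h.map_add] at this; exact this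
    · change (p x + p y) * (p x + p y) = p x + p y
      rw [add_mul, mul_add, mul_add, hpq x y hxy, hpq y x hxy.symm, (hp x).1.eq, (hp y).1.eq]
      simp
  have key : ∀ f : ℝ → ℝ, h.toLinearMap (∑ x ∈ s, f x • P x) = ∑ x ∈ s, f x • (γ (P x) : ℬ) := by
    intro f; rw [_root_.map_sum]; refine Finset.sum_congr rfl fun x _ => ?_
    rw [_root_.map_smul]; rfl
  have e1 : a = ∑ x ∈ s, x • P x := by
    apply Subtype.ext
    rw [hs]
    simp [P]
  have e2 : c = ∑ x ∈ s, (x * x) • P x := by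
    apply Subtype.ext
    rw [hc, hs, Finset.sum_smul_mul_self_of_orthogonal s _ p (fun x => (hp x).1.eq) hpq]
    simp [P]
  change h.toLinearMap c = h.toLinearMap a * h.toLinearMap a
  rw [e1, e2, key, key, Finset.sum_smul_mul_self_of_orthogonal s _ (fun x => (γ (P x) : ℬ))
    (fun x => (hP x).eq) hPQ]

/-- The complex linear extension of an encoding of all self-adjoint elements is a Jordan
`*`-homomorphism. -/
theorem exists_jordanHom (h : IsEncoding γ) :
    ∃ θ : 𝒜 →ₗ[ℂ] ℬ, (∀ a : (SpecialJBAlgebra.full 𝒜).Elt, θ a = γ a) ∧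
      (∀ x, θ (star x) = star (θ x)) ∧ ∀ x, θ (x * x) = θ x * θ x := by
  obtain ⟨θ, hθ⟩ := selfAdjoint.exists_complexLinear_extension (𝒜 := 𝒜) (ℬ := ℬ)
    { toFun := fun a => γ ⟨a, a.2⟩
      map_add' := fun a b => h.toLinearMap.map_add ⟨a, a.2⟩ ⟨b, b.2⟩
      map_smul' := fun t a => h.toLinearMap.map_smul t ⟨a, a.2⟩ }
  have hθ' : ∀ a : (SpecialJBAlgebra.full 𝒜).Elt, θ a = γ a := fun a => hθ ⟨a, a.2⟩
  have hstar : ∀ a : 𝒜, IsSelfAdjoint a → star (θ a) = θ a := fun a ha => by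
    rw [hθ' ⟨a, ha⟩]; exact B.isSelfAdjoint' (γ _).2
  have hsq : ∀ a : 𝒜, IsSelfAdjoint a → θ (a * a) = θ a * θ a := fun a ha => by
    have h2 : IsSelfAdjoint (a * a) := by
      have := ha.pow 2
      rwa [pow_two] at this
    rw [hθ' ⟨a, ha⟩, hθ' ⟨a * a, h2⟩]
    exact h.map_mul_self rfl
  have hdec : ∀ x : 𝒜, ∃ a b, IsSelfAdjoint a ∧ IsSelfAdjoint b ∧ x = a + Complex.I • b :=
    fun x => ⟨_, _, (realPart x).2, (imaginaryPart x).2, (realPart_add_I_smul_imaginaryPart x).symm⟩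
  refine ⟨θ, hθ', fun x => ?_, fun x => ?_⟩
  · obtain ⟨a, b, ha, hb, rfl⟩ := hdec x
    simp [ha.star_eq, hb.star_eq, hstar a ha, hstar b hb]
  · obtain ⟨a, b, ha, hb, rfl⟩ := hdec x
    -- Polarising the square rule at a + b handles the cross term of (a + ib)².
    have hab := hsq _ (ha.add hb)
    have e : ∀ u v : 𝒜, (u + v) * (u + v) = u * u + (u * v + v * u) + v * v := fun u v => by
      noncomm_ring
    have hab' : θ (a * b + b * a) = θ a * θ b + θ b * θ a := by
      rw [e, _root_.map_add, _root_.map_add, hsq a ha, hsq b hb,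
        _root_.map_add θ a b] at hab
      have : θ (a * b + b * a) = (θ a * θ a + θ (a * b + b * a) + θ b * θ b)
        - θ a * θ a - θ b * θ b := by abel
      rw [this, hab]
      noncomm_ring
    have e2 : (a + Complex.I • b) * (a + Complex.I • b)
        = a * a - b * b + Complex.I • (a * b + b * a) := by
      simp only [add_mul, mul_add, smul_mul_assoc, mul_smul_comm, smul_smul, Complex.I_mul_I,
        smul_add]
      module
    rw [e2, _root_.map_add, _root_.map_sub, _root_.map_smul, hab', hsq a ha, hsq b hb,
      _root_.map_add, _root_.map_smul]
    simp only [add_mul, mul_add, smul_mul_assoc, mul_smul_comm, smul_smul, Complex.I_mul_I,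
        smul_add]
    module

end IsEncoding

/-! ### Jordan `*`-homomorphisms and sums over matrix units -/

/-- A complex linear Jordan `*`-homomorphism. -/
structure IsJordanStarHom {S R : Type*} [Ring S] [StarRing S] [Algebra ℂ S] [Ring R] [StarRing R]
    [Algebra ℂ R] (θ : S →ₗ[ℂ] R) : Prop where
  map_mul_self : ∀ x, θ (x * x) = θ x * θ x
  map_star : ∀ x, θ (star x) = star (θ x)

namespace IsJordanStarHom

section general

variable {S R : Type*} [Ring S] [StarRing S] [Algebra ℂ S] [Ring R] [StarRing R]
    [Algebra ℂ R] {θ : S →ₗ[ℂ] R}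

theorem map_jordan (h : IsJordanStarHom θ) (x y : S) :
    θ (x * y + y * x) = θ x * θ y + θ y * θ x := by
  have e : x * y + y * x = (x + y) * (x + y) - x * x - y * y := by noncomm_ring
  rw [e, map_sub, map_sub, h.map_mul_self, h.map_mul_self, h.map_mul_self, map_add]
  noncomm_ring

theorem map_isIdempotentElem (h : IsJordanStarHom θ) {p : S} (hp : IsIdempotentElem p) :
    IsIdempotentElem (θ p) := by
  rw [IsIdempotentElem, ← h.map_mul_self, hp.eq]

theorem map_mul_eq_zero (h : IsJordanStarHom θ) {p q : S} (hp : IsIdempotentElem p)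
    (hpq : p * q = 0) (hqp : q * p = 0) : θ p * θ q = 0 ∧ θ q * θ p = 0 :=
  (h.map_isIdempotentElem hp).annihilate_of_anticommute <| by
    rw [← h.map_jordan, hpq, hqp, add_zero, map_zero]

end general

/-- The linear map `∑ xᵣₛ Wᵣₛ`. -/
def unitSum {ι R : Type*} [Fintype ι] [Ring R] [Algebra ℂ R] (W : ι → ι → R) :
    Matrix ι ι ℂ →ₗ[ℂ] R where
  toFun x := ∑ r, ∑ s, x r s • W r s
  map_add' x y := by simp [add_smul, Finset.sum_add_distrib]
  map_smul' c x := by simp [mul_smul, Finset.smul_sum]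

section unitSum

variable {ι R : Type*} [Fintype ι] [Ring R] [Algebra ℂ R]

theorem unitSum_apply (W : ι → ι → R) (x : Matrix ι ι ℂ) :
    unitSum W x = ∑ r, ∑ s, x r s • W r s := rfl

theorem unitSum_mul [DecidableEq ι] {W : ι → ι → R} (h1 : ∀ r s t, W r s * W s t = W r t)
    (h0 : ∀ r s s' t, s ≠ s' → W r s * W s' t = 0) (x y : Matrix ι ι ℂ) :
    unitSum W (x * y) = unitSum W x * unitSum W y := by
  have key : ∀ r, (∑ s, x r s • W r s) * unitSum W y = ∑ t, (x * y) r t • W r t := by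
    intro r
    simp only [unitSum_apply, Finset.sum_mul_sum, Matrix.mul_apply, Finset.sum_smul]
    rw [Finset.sum_comm (s := Finset.univ) (t := Finset.univ)
      (f := fun t s => (x r s * y s t) • W r t)]
    refine Finset.sum_congr rfl fun s _ => ?_
    rw [Finset.sum_eq_single s]
    · simp only [Finset.mul_sum, smul_mul_smul_comm, h1]
    · intro s' _ hs
      simp only [Finset.mul_sum, smul_mul_smul_comm, h0 r s s' _ hs.symm, smul_zero,
        Finset.sum_const_zero]
    · simp
  rw [unitSum_apply, unitSum_apply W x, Finset.sum_mul]
  exact Finset.sum_congr rfl fun r _ => (key r).symm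

theorem unitSum_mul_unitSum_eq_zero {W V : ι → ι → R}
    (h0 : ∀ r s s' t, W r s * V s' t = 0) (x y : Matrix ι ι ℂ) :
    unitSum W x * unitSum V y = 0 := by
  simp only [unitSum_apply, Finset.sum_mul, Finset.mul_sum, smul_mul_smul_comm, h0, smul_zero,
    Finset.sum_const_zero]

theorem star_unitSum [StarRing R] [StarModule ℂ R] {W : ι → ι → R}
    (h : ∀ r s, star (W r s) = W s r) (x : Matrix ι ι ℂ) :
    star (unitSum W x) = unitSum W (star x) := by
  simp only [unitSum_apply, star_sum, star_smul, h, Matrix.star_apply]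
  exact Finset.sum_comm

end unitSum

/-! ### Splitting a Jordan homomorphism of a matrix algebra -/

section matrix

set_option linter.unusedSectionVars false

variable {ι R : Type*} [Fintype ι] [DecidableEq ι] [Ring R] [StarRing R] [Algebra ℂ R]

/-- Precomposition with the transpose. -/
def transpose (θ : Matrix ι ι ℂ →ₗ[ℂ] R) : Matrix ι ι ℂ →ₗ[ℂ] R :=
  θ ∘ₗ (Matrix.transposeLinearEquiv ι ι ℂ ℂ).toLinearMap

theorem transpose_apply (θ : Matrix ι ι ℂ →ₗ[ℂ] R) (x) : transpose θ x = θ xᵀ := rfl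

/-- The off-diagonal matrix units `θ(eᵣᵣ) θ(eᵣₛ) θ(eₛₛ)` of the multiplicative part of `θ`. -/
def corner (θ : Matrix ι ι ℂ →ₗ[ℂ] R) (r s : ι) : R :=
  θ (Matrix.single r r 1) * θ (Matrix.single r s 1) * θ (Matrix.single s s 1)

variable {θ : Matrix ι ι ℂ →ₗ[ℂ] R}

theorem of_transpose (h : IsJordanStarHom θ) : IsJordanStarHom (transpose θ) where
  map_mul_self x := by simp only [transpose_apply, Matrix.transpose_mul, h.map_mul_self]
  map_star x := by
    simp only [transpose_apply, ← h.map_star]; rfl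

theorem diag_idem (h : IsJordanStarHom θ) (r : ι) :
    θ (Matrix.single r r 1) * θ (Matrix.single r r 1) = θ (Matrix.single r r 1) := by
  rw [← h.map_mul_self]; simp

theorem diag_mul_of_ne (h : IsJordanStarHom θ) {r s t : ι} (h1 : t ≠ r) (h2 : t ≠ s) :
    θ (Matrix.single t t 1) * θ (Matrix.single r s 1) = 0 ∧
      θ (Matrix.single r s 1) * θ (Matrix.single t t 1) = 0 := by
  apply h.map_mul_eq_zero
  · simp [IsIdempotentElem]
  · rw [Matrix.single_mul_single_of_ne _ _ _ _ h1]
  · rw [Matrix.single_mul_single_of_ne _ _ _ _ h2.symm]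

/-- Peirce decomposition: with Eᵣ = θ(eᵣᵣ), only Eᵣ θ(eᵣₛ) Eₛ and Eₛ θ(eᵣₛ) Eᵣ survive, and the
latter is the corner (s, r) of the transposed map. -/
theorem map_single_of_ne (h : IsJordanStarHom θ) {r s : ι} (hrs : r ≠ s) :
    θ (Matrix.single r s 1) = corner θ r s + corner (transpose θ) s r := by
  have h1 := h.map_jordan (Matrix.single r r 1) (Matrix.single r s 1)
  have h2 := h.map_jordan (Matrix.single r s 1) (Matrix.single s s 1)
  rw [Matrix.single_mul_single_of_ne _ _ _ _ hrs.symm] at h1 h2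
  simp only [Matrix.single_mul_single_same, mul_one, add_zero] at h1 h2
  have h3 := (h.diag_mul_of_ne hrs hrs).1
  have h4 := (h.diag_mul_of_ne hrs hrs).2
  simp only [corner, transpose_apply, Matrix.transpose_single]
  conv_lhs => rw [h1, h2]
  simp only [mul_add, add_mul, ← mul_assoc, h3]
  simp only [mul_assoc, h4]
  simp

theorem diag_mul (h : IsJordanStarHom θ) {r s : ι} (hrs : r ≠ s) :
    θ (Matrix.single r r 1) * θ (Matrix.single r s 1) = corner θ r s := by
  rw [h.map_single_of_ne hrs, mul_add, corner, corner, transpose_apply, transpose_apply,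
    Matrix.transpose_single, Matrix.transpose_single, ← mul_assoc, ← mul_assoc, ← mul_assoc,
    ← mul_assoc, h.diag_idem, (h.diag_mul_of_ne hrs hrs).1]
  simp

theorem mul_diag (h : IsJordanStarHom θ) {r s : ι} (hrs : r ≠ s) :
    θ (Matrix.single r s 1) * θ (Matrix.single s s 1) = corner θ r s := by
  rw [h.map_single_of_ne hrs, add_mul, corner, corner, transpose_apply, transpose_apply,
    transpose_apply, Matrix.transpose_single, Matrix.transpose_single, Matrix.transpose_single,
    mul_assoc, h.diag_idem, mul_assoc _ (θ (Matrix.single r r 1)),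
    (h.diag_mul_of_ne hrs hrs).1]
  simp

/-- Since r ≠ t, the Jordan product of eᵣₛ and eₛₜ is eᵣₜ; multiplying on the left by θ(eᵣᵣ) kills
the summand in the wrong order. -/
theorem corner_mul_corner (h : IsJordanStarHom θ) {r s t : ι} (hrs : r ≠ s) (hst : s ≠ t)
    (hrt : r ≠ t) : corner θ r s * corner θ s t = corner θ r t := by
  have h1 := h.map_jordan (Matrix.single r s 1) (Matrix.single s t 1)
  rw [Matrix.single_mul_single_of_ne _ _ _ _ hrt.symm, Matrix.single_mul_single_same] at h1
  rw [corner.eq_1 θ r t, ← h.diag_mul hrs, ← h.mul_diag hst]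
  simp only [mul_one, add_zero] at h1
  rw [h1, mul_add, ← mul_assoc _ (θ (Matrix.single s t 1)) (θ (Matrix.single r s 1)),
    (h.diag_mul_of_ne hrs hrt).1]
  simp [mul_assoc]

/-- Compress the image of eᵣₛeₛᵣ + eₛᵣeᵣₛ = eᵣᵣ + eₛₛ by θ(eᵣᵣ). The two terms are the shares of
θ(eᵣᵣ) in the multiplicative and the antimultiplicative part. -/
theorem corner_mul_corner_add (h : IsJordanStarHom θ) {r s : ι} (hrs : r ≠ s) :
    corner θ r s * corner θ s r + corner (transpose θ) r s * corner (transpose θ) s r =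
      θ (Matrix.single r r 1) := by
  have h1 := h.map_jordan (Matrix.single r s 1) (Matrix.single s r 1)
  have ht := h.of_transpose
  rw [← h.diag_mul hrs, ← h.mul_diag hrs.symm, ← ht.diag_mul hrs, ← ht.mul_diag hrs.symm]
  simp only [transpose_apply, Matrix.transpose_single, Matrix.single_mul_single_same, mul_one,
    map_add] at h1 ⊢
  have h2 := congrArg (fun z => θ (Matrix.single r r 1) * z * θ (Matrix.single r r 1)) h1
  simp only [mul_add, add_mul, h.diag_idem, (h.diag_mul_of_ne hrs hrs).1, add_zero] at h2
  simp only [mul_assoc] at h2 ⊢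
  exact h2.symm

/-- The product is Eᵣ θ(eᵣₛ) θ(eₜₛ) Eₜ with Eᵣ = θ(eᵣᵣ). For r = t it contains θ(eᵣₛ)² = 0;
otherwise the middle factors anticommute and Eᵣ kills θ(eₜₛ). -/
theorem corner_mul_corner_transpose (h : IsJordanStarHom θ) {r s t : ι} (hrs : r ≠ s)
    (hst : s ≠ t) : corner θ r s * corner (transpose θ) s t = 0 := by
  rw [← h.diag_mul hrs, ← h.of_transpose.mul_diag hst]
  simp only [transpose_apply, Matrix.transpose_single]
  rcases eq_or_ne r t with rfl | hrt
  · have h1 := h.map_mul_self (Matrix.single r s 1)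
    rw [Matrix.single_mul_single_of_ne _ _ _ _ hrs.symm, map_zero] at h1
    rw [mul_assoc, ← mul_assoc (θ (Matrix.single r s 1)), ← h1]
    simp
  · have h1 := h.map_jordan (Matrix.single r s 1) (Matrix.single t s 1)
    rw [Matrix.single_mul_single_of_ne _ _ _ _ hst, Matrix.single_mul_single_of_ne _ _ _ _ hrs.symm,
      add_zero, map_zero] at h1
    rw [mul_assoc, ← mul_assoc (θ (Matrix.single r s 1)), eq_neg_of_add_eq_zero_left h1.symm,
      neg_mul, mul_neg, mul_assoc, ← mul_assoc, (h.diag_mul_of_ne hrt hrs).1]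
    simp

theorem star_corner (h : IsJordanStarHom θ) (r s : ι) : star (corner θ r s) = corner θ s r := by
  simp only [corner, star_mul, ← h.map_star, Matrix.star_eq_conjTranspose,
    Matrix.conjTranspose_single, star_one, mul_assoc]

variable [Nontrivial ι]

/-- The matrix units of the multiplicative part of `θ`. -/
noncomputable def unit (θ : Matrix ι ι ℂ →ₗ[ℂ] R) (r s : ι) : R :=
  if r = s then corner θ r (exists_ne r).choose * corner θ (exists_ne r).choose r
  else corner θ r s

theorem unit_of_ne {r s : ι} (hrs : r ≠ s) : unit θ r s = corner θ r s := if_neg hrs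

/-- The auxiliary index does not matter: writing c for the corners, cᵣₜcₜᵣ = cᵣₜcₜₛcₛᵣ = cᵣₛcₛᵣ. -/
theorem unit_self (h : IsJordanStarHom θ) {r s : ι} (hrs : r ≠ s) :
    unit θ r r = corner θ r s * corner θ s r := by
  rw [unit, if_pos rfl]
  have ht := (exists_ne r).choose_spec
  set t := (exists_ne r).choose
  rcases eq_or_ne s t with rfl | hst
  · rfl
  · rw [← h.corner_mul_corner hst.symm hrs.symm ht, ← mul_assoc,
      h.corner_mul_corner ht.symm hst.symm hrs]

theorem diag_mul_unit (h : IsJordanStarHom θ) (r s : ι) :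
    θ (Matrix.single r r 1) * unit θ r s = unit θ r s := by
  rcases eq_or_ne r s with rfl | hrs
  · obtain ⟨t, ht⟩ := exists_ne r
    rw [h.unit_self ht.symm, corner]
    simp only [← mul_assoc, h.diag_idem]
  · rw [unit_of_ne hrs, corner]
    simp only [← mul_assoc, h.diag_idem]

theorem unit_mul_diag (h : IsJordanStarHom θ) (r s : ι) :
    unit θ r s * θ (Matrix.single s s 1) = unit θ r s := by
  rcases eq_or_ne r s with rfl | hrs
  · obtain ⟨t, ht⟩ := exists_ne r
    rw [h.unit_self ht.symm, corner]
    simp only [corner, mul_assoc, h.diag_idem]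
  · rw [unit_of_ne hrs, corner]
    simp only [mul_assoc, h.diag_idem]

theorem unit_mul_unit_of_ne (h : IsJordanStarHom θ) {r s s' t : ι} (hs : s ≠ s') :
    unit θ r s * unit θ s' t = 0 := by
  rw [← h.unit_mul_diag r s, ← h.diag_mul_unit s' t, mul_assoc, ← mul_assoc (θ _),
    (h.diag_mul_of_ne hs hs).1]
  simp

/-- Multiply the splitting of θ(eᵣᵣ) by the corner; the antimultiplicative share annihilates it. -/
theorem corner_triple (h : IsJordanStarHom θ) {r s : ι} (hrs : r ≠ s) :
    corner θ r s * corner θ s r * corner θ r s = corner θ r s := by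
  have h1 := congrArg (· * corner θ r s) (h.corner_mul_corner_add hrs)
  have h2 : corner (transpose θ) s r * corner θ r s = 0 :=
    h.of_transpose.corner_mul_corner_transpose hrs.symm hrs
  simp only [add_mul, mul_assoc, h2, mul_zero, add_zero] at h1
  rw [mul_assoc, h1, corner]
  simp only [← mul_assoc, h.diag_idem]

theorem unit_mul_unit (h : IsJordanStarHom θ) (r s t : ι) :
    unit θ r s * unit θ s t = unit θ r t := by
  rcases eq_or_ne r s with rfl | hrs
  · rcases eq_or_ne r t with rfl | hrt
    · obtain ⟨t, ht⟩ := exists_ne r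
      rw [h.unit_self ht.symm, ← mul_assoc, h.corner_triple ht.symm]
    · rw [h.unit_self hrt, unit_of_ne hrt, h.corner_triple hrt]
  · rcases eq_or_ne s t with rfl | hst
    · rw [h.unit_self hrs.symm, unit_of_ne hrs, ← mul_assoc, h.corner_triple hrs]
    · rcases eq_or_ne r t with rfl | hrt
      · rw [h.unit_self hrs, unit_of_ne hrs, unit_of_ne hst]
      · rw [unit_of_ne hrs, unit_of_ne hst, unit_of_ne hrt, h.corner_mul_corner hrs hst hrt]

theorem unit_mul_unit_transpose (h : IsJordanStarHom θ) (r s s' t : ι) :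
    unit θ r s * unit (transpose θ) s' t = 0 := by
  have ht := h.of_transpose
  rcases eq_or_ne s s' with rfl | hs
  · have key : ∀ r s t : ι, s ≠ t → unit θ r s * unit (transpose θ) s t = 0 := by
      intro r s t hst
      rcases eq_or_ne r s with rfl | hrs
      · rw [h.unit_self hst, unit_of_ne hst, mul_assoc,
          h.corner_mul_corner_transpose hst.symm hst, mul_zero]
      · rw [unit_of_ne hrs, unit_of_ne hst, h.corner_mul_corner_transpose hrs hst]
    rcases eq_or_ne s t with rfl | hst
    · obtain ⟨t, hts⟩ := exists_ne s
      rw [ht.unit_self hts.symm, ← mul_assoc, ← unit_of_ne hts.symm, key r s t hts.symm, zero_mul]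
    · exact key r s t hst
  · rw [← h.unit_mul_diag r s, ← ht.diag_mul_unit s' t, mul_assoc, ← mul_assoc (θ _)]
    rw [transpose_apply, Matrix.transpose_single, (h.diag_mul_of_ne hs hs).1]
    simp

theorem star_unit (h : IsJordanStarHom θ) (r s : ι) : star (unit θ r s) = unit θ s r := by
  rcases eq_or_ne r s with rfl | hrs
  · obtain ⟨t, ht⟩ := exists_ne r
    rw [h.unit_self ht.symm, star_mul, h.star_corner, h.star_corner]
  · rw [unit_of_ne hrs, unit_of_ne hrs.symm, h.star_corner]

theorem map_single (h : IsJordanStarHom θ) (r s : ι) :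
    θ (Matrix.single r s 1) = unit θ r s + unit (transpose θ) s r := by
  rcases eq_or_ne r s with rfl | hrs
  · obtain ⟨t, ht⟩ := exists_ne r
    rw [h.unit_self ht.symm, h.of_transpose.unit_self ht.symm, h.corner_mul_corner_add ht.symm]
  · rw [unit_of_ne hrs, unit_of_ne hrs.symm, ← h.map_single_of_ne hrs]

/-- The first summand is multiplicative in x, the second antimultiplicative. -/
theorem eq_unitSum_add (h : IsJordanStarHom θ) (x : Matrix ι ι ℂ) :
    θ x = unitSum (unit θ) x + unitSum (unit (transpose θ)) xᵀ := by
  have e : unitSum (unit (transpose θ)) xᵀ = ∑ r, ∑ s, x r s • unit (transpose θ) s r := by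
    rw [unitSum_apply, Finset.sum_comm]; rfl
  rw [e, unitSum_apply, ← Finset.sum_add_distrib]
  conv_lhs => rw [Matrix.matrix_eq_sum_single x]
  simp only [map_sum, ← Finset.sum_add_distrib, ← smul_add, ← h.map_single]
  refine Finset.sum_congr rfl fun r _ => Finset.sum_congr rfl fun s _ => ?_
  rw [← map_smul]
  congr 1
  simp

end matrix

/-- A Jordan `*`-homomorphism of a matrix algebra agrees on self-adjoint matrices with a
(real linear) `*`-homomorphism. -/
theorem exists_nonUnitalRingHom {ι R : Type*} [Fintype ι] [DecidableEq ι] [Ring R] [StarRing R]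
    [Algebra ℂ R] [StarModule ℂ R] {θ : Matrix ι ι ℂ →ₗ[ℂ] R} (h : IsJordanStarHom θ) :
    ∃ Γ : Matrix ι ι ℂ →ₙ+* R, (∀ x, Γ (star x) = star (Γ x)) ∧
      ∀ x, IsSelfAdjoint x → Γ x = θ x := by
  rcases subsingleton_or_nontrivial ι with hι | hι
  -- In size at most 1 every matrix is scalar, so θ itself is multiplicative.
  · have hs : ∀ x : Matrix ι ι ℂ, ∃ c : ℂ, x = c • (1 : Matrix ι ι ℂ) := by
      intro x
      rcases isEmpty_or_nonempty ι with hι | ⟨⟨i⟩⟩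
      · exact ⟨0, Subsingleton.elim _ _⟩
      · refine ⟨x i i, ?_⟩
        ext r s
        rw [Subsingleton.elim r i, Subsingleton.elim s i]
        simp
    refine ⟨⟨⟨θ, fun x y => ?_⟩, map_zero θ, map_add θ⟩, h.map_star, fun _ _ => rfl⟩
    obtain ⟨a, rfl⟩ := hs x
    obtain ⟨b, rfl⟩ := hs y
    have h1 : θ 1 * θ 1 = θ 1 := by rw [← h.map_mul_self, one_mul]
    rw [smul_mul_smul_comm, one_mul, map_smul, map_smul, map_smul, smul_mul_smul_comm, h1]
  · have ht := h.of_transpose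
    have key : ∀ x y : Matrix ι ι ℂ,
      (x * y).map (starRingEnd ℂ) = x.map (starRingEnd ℂ) * y.map (starRingEnd ℂ) := by
      intro x y; rw [Matrix.map_mul]
    -- Conjugation in place of the transpose preserves the order of products; the two agree on
    -- self-adjoint x.
    let g : Matrix ι ι ℂ → R := fun x =>
      unitSum (unit θ) x + unitSum (unit (transpose θ)) (x.map (starRingEnd ℂ))
    have hg : ∀ x, g x =
      unitSum (unit θ) x + unitSum (unit (transpose θ)) (x.map (starRingEnd ℂ)) := fun _ => rfl
    have hmul : ∀ x y, g (x * y) = g x * g y := fun x y => by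
      rw [hg, hg, hg, key, unitSum_mul h.unit_mul_unit fun _ _ _ _ => h.unit_mul_unit_of_ne,
        unitSum_mul ht.unit_mul_unit fun _ _ _ _ => ht.unit_mul_unit_of_ne, mul_add, add_mul,
        add_mul, unitSum_mul_unitSum_eq_zero h.unit_mul_unit_transpose,
        unitSum_mul_unitSum_eq_zero (W := unit (transpose θ)) (V := unit θ)
          ht.unit_mul_unit_transpose, add_zero, zero_add]
    have hadd : ∀ x y, g (x + y) = g x + g y := fun x y => by
      rw [hg, hg, hg, Matrix.map_add _ (fun a b => map_add _ a b), map_add, map_add]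
      abel
    refine ⟨⟨⟨g, hmul⟩, by simp [g], hadd⟩, fun x => ?_, fun x hx => ?_⟩
    · change g (star x) = star (g x)
      rw [hg, hg, star_add, star_unitSum h.star_unit, star_unitSum ht.star_unit]
      rfl
    · rw [h.eq_unitSum_add]
      change g x = _
      rw [hg]
      congr 2
      conv_rhs => rw [← hx.star_eq]
      ext r s
      simp [Matrix.star_apply]

/-- A unital Jordan `*`-homomorphism of a sum of matrix algebras agrees on self-adjoint elements
with a (real linear) `*`-homomorphism. -/
theorem exists_ringHom {l : ℕ} {n : Fin l → ℕ} {R : Type*} [Ring R] [StarRing R]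
    [Algebra ℂ R] [StarModule ℂ R] {θ : MatrixSum n →ₗ[ℂ] R} (h : IsJordanStarHom θ)
    (h1 : θ 1 = 1) :
    ∃ Γ : MatrixSum n →+* R, (∀ x, Γ (star x) = star (Γ x)) ∧
      ∀ x, IsSelfAdjoint x → Γ x = θ x := by
  have hj : ∀ j, IsJordanStarHom (θ ∘ₗ LinearMap.single ℂ
      (fun j => Matrix (Fin (n j)) (Fin (n j)) ℂ) j) := fun j =>
    { map_mul_self := fun x => by
        simp only [LinearMap.comp_apply, LinearMap.single_apply, Pi.single_mul, h.map_mul_self]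
      map_star := fun x => by
        simp only [LinearMap.comp_apply, LinearMap.single_apply, ← h.map_star, Pi.single_star] }
  choose Γ hΓs hΓ using fun j => (hj j).exists_nonUnitalRingHom
  have hone : ∀ j, Γ j 1 = θ (Pi.single j 1) := fun j => hΓ j 1 (IsSelfAdjoint.one _)
  have horth : ∀ i j x y, i ≠ j → Γ i x * Γ j y = 0 := by
    intro i j x y hij
    -- The ranges are separated by the images of the block identities, which are orthogonal
    -- idempotents.
    rw [← mul_one x, ← one_mul y, map_mul, map_mul, hone, hone, mul_assoc, ← mul_assoc (θ _),
      (h.map_mul_eq_zero _ _ _).1]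
    · simp
    · rw [IsIdempotentElem, ← Pi.single_mul, one_mul]
    · ext k; by_cases hk : k = i
      · subst hk; simp [hij]
      · simp [hk]
    · ext k; by_cases hk : k = i
      · subst hk; simp [hij]
      · simp [hk]
  have hsum : ∀ x : MatrixSum n, x = ∑ j, Pi.single j (x j) := fun x =>
    (Finset.univ_sum_single x).symm
  refine ⟨⟨⟨⟨fun x => ∑ j, Γ j (x j), ?_⟩, fun x y => ?_⟩, ?_, fun x y => ?_⟩, fun x => ?_,
    fun x hx => ?_⟩
  · simp only [Pi.one_apply, hone, ← map_sum]
    rw [← h1]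
    exact congrArg θ (hsum 1).symm
  · simp only [Pi.mul_apply, map_mul, Finset.sum_mul_sum]
    refine Finset.sum_congr rfl fun i _ => ?_
    rw [Finset.sum_eq_single i (fun j _ hji => horth _ _ _ _ hji.symm) (by simp)]
  · simp
  · simp [Finset.sum_add_distrib]
  · change ∑ j, Γ j (star x j) = star (∑ j, Γ j (x j))
    simp [star_sum, hΓs]
  · change ∑ j, Γ j (x j) = _
    conv_rhs => rw [hsum x, map_sum]
    refine Finset.sum_congr rfl fun j _ => hΓ j (x j) ?_
    exact congrFun hx.star_eq j

end IsJordanStarHom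

/-! ### Generation by self-adjoint elements -/

/-- Once i·1 of a block lies in `S`, so does every Re x + i Im x. Blocks of size 1 need `h1`, since
their self-adjoint elements generate only ℝ. -/
theorem MatrixSum.subring_eq_top {l : ℕ} {n : Fin l → ℕ} (S : Subring (MatrixSum n))
    (hS : ∀ x, IsSelfAdjoint x → x ∈ S) (h1 : ∀ j, n j = 1 → ∀ z, Pi.single j z ∈ S) : S = ⊤ := by
  rw [eq_top_iff]
  intro x _
  rw [← Finset.univ_sum_single x]
  refine Subring.sum_mem _ fun j _ => ?_
  have hsa : ∀ z : Matrix (Fin (n j)) (Fin (n j)) ℂ, IsSelfAdjoint z →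
      (Pi.single j z : MatrixSum n) ∈ S := fun z hz =>
    hS _ (by rw [IsSelfAdjoint, ← Pi.single_star, hz.star_eq])
  by_cases hj : n j = 1
  · exact h1 j hj _
  rcases subsingleton_or_nontrivial (Fin (n j)) with hs | hs
  · have h0 : n j = 0 := by
      rw [Fin.subsingleton_iff_le_one] at hs; omega
    have : IsEmpty (Fin (n j)) := by rw [h0]; infer_instance
    rw [Subsingleton.elim (x j) 0, Pi.single_zero]
    exact S.zero_mem
  · have hI : (Pi.single j (Complex.I • 1) : MatrixSum n) ∈ S := by
      have e : (Complex.I • 1 : Matrix (Fin (n j)) (Fin (n j)) ℂ) =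
          ∑ r, Matrix.single r r Complex.I := by
        rw [Matrix.smul_one_eq_diagonal]
        exact (Matrix.sum_single_eq_diagonal _).symm
      have e2 : (Pi.single j (Complex.I • 1) : MatrixSum n) =
          ∑ r, Pi.single j (Matrix.single r r Complex.I) := by
        rw [e]; exact map_sum (AddMonoidHom.single _ j) _ _
      rw [e2]
      refine Subring.sum_mem _ fun r _ => ?_
      obtain ⟨s, hsr⟩ := exists_ne r
      -- The Pauli relation σₓσ_y = iσ_z on the indices r, s, cut down to the entry (r, r).
      have e3 : Matrix.single r r Complex.I = (Matrix.single r s 1 + Matrix.single s r 1) *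
          (Matrix.single r s (-Complex.I) + Matrix.single s r Complex.I) *
          Matrix.single r r (1 : ℂ) := by
        simp [add_mul, mul_add, hsr, hsr.symm]
      rw [e3, Pi.single_mul, Pi.single_mul]
      refine S.mul_mem (S.mul_mem (hsa _ ?_) (hsa _ ?_)) (hsa _ ?_)
      all_goals
        simp [IsSelfAdjoint, Matrix.star_eq_conjTranspose, add_comm]
    have e : x j = (realPart (x j) : Matrix (Fin (n j)) (Fin (n j)) ℂ) +
        (Complex.I • 1) * (imaginaryPart (x j) : Matrix (Fin (n j)) (Fin (n j)) ℂ) := by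
      rw [smul_mul_assoc, one_mul, realPart_add_I_smul_imaginaryPart]
    rw [e, Pi.single_add, Pi.single_mul]
    exact S.add_mem (hsa _ (realPart (x j)).2) (S.mul_mem hI (hsa _ (imaginaryPart (x j)).2))

/-! ### Matrix units and adapted orthonormal bases -/

/-- A complete system of matrix units, for a family of matrix algebras. -/
structure IsMatrixUnits {T R : Type*} [Fintype T] [Ring R] [StarRing R] {N : T → ℕ}
    (W : ∀ t, Fin (N t) → Fin (N t) → R) : Prop where
  mul_same : ∀ t r s u, W t r s * W t s u = W t r u
  mul_of_ne : ∀ t r s s' u, s ≠ s' → W t r s * W t s' u = 0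
  mul_of_ne_block : ∀ t t' r s s' u, t ≠ t' → W t r s * W t' s' u = 0
  star_eq : ∀ t r s, star (W t r s) = W t s r
  sum_eq_one : ∑ t, ∑ r, W t r r = 1

/-- A complete system of matrix units acts on a suitable orthonormal basis by permuting it. -/
theorem IsMatrixUnits.exists_orthonormalBasis {T H : Type*} [Fintype T] [NormedAddCommGroup H]
    [InnerProductSpace ℂ H] [FiniteDimensional ℂ H] {N : T → ℕ} (hN : ∀ t, 0 < N t)
    {W : ∀ t, Fin (N t) → Fin (N t) → H →L[ℂ] H} (h : IsMatrixUnits W) :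
    ∃ (d : T → ℕ) (b : OrthonormalBasis (Σ t, Fin (N t) × Fin (d t)) ℂ H),
      ∀ t r s x, W t r s (b ⟨t, (s, x)⟩) = b ⟨t, (r, x)⟩ := by
  classical
  let z : ∀ t, Fin (N t) := fun t => ⟨0, hN t⟩
  -- The range of one diagonal unit is the multiplicity space; the units `W t r (z t)` carry its
  -- orthonormal basis isometrically to the other diagonal ranges.
  let V : T → Submodule ℂ H := fun t => LinearMap.range (W t (z t) (z t) : H →ₗ[ℂ] H)
  have hV : ∀ t, ∀ y ∈ V t, W t (z t) (z t) y = y := by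
    rintro t _ ⟨y, rfl⟩
    exact DFunLike.congr_fun (h.mul_same t (z t) (z t) (z t)) y
  have hVmem : ∀ t r y, W t (z t) r y ∈ V t := fun t r y =>
    ⟨W t (z t) r y, DFunLike.congr_fun (h.mul_same t (z t) (z t) r) y⟩
  let v : ∀ t, OrthonormalBasis (Fin (Module.finrank ℂ (V t))) ℂ (V t) := fun t =>
    stdOrthonormalBasis ℂ (V t)
  let f : (Σ t, Fin (N t) × Fin (Module.finrank ℂ (V t))) → H := fun κ =>
    W κ.1 κ.2.1 (z κ.1) (v κ.1 κ.2.2 : H)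
  have hinner : ∀ t r s (x y : H), inner ℂ (W t r s x) y = inner ℂ x (W t s r y) := by
    intro t r s x y
    rw [← h.star_eq t r s, ContinuousLinearMap.star_eq_adjoint,
      ContinuousLinearMap.adjoint_inner_right]
  have hf : Orthonormal ℂ f := by
    rw [orthonormal_iff_ite]
    rintro ⟨t, r, x⟩ ⟨t', r', x'⟩
    simp only [f, hinner]
    rw [← mul_apply_eq_comp]
    by_cases ht : t = t'
    · subst ht
      by_cases hr : r = r'
      · subst hr
        rw [h.mul_same, hV _ _ (v t x').2]
        have := orthonormal_iff_ite.1 (v t).orthonormal x x'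
        rw [Submodule.coe_inner] at this
        simp [this]
      · rw [h.mul_of_ne _ _ _ _ _ hr]
        simp [hr]
    · rw [h.mul_of_ne_block _ _ _ _ _ _ ht]
      simp [ht]
  have hspan : ⊤ ≤ Submodule.span ℂ (Set.range f) := by
    intro y _
    have hy : y = ∑ t, ∑ r, W t r r y := by
      have := DFunLike.congr_fun h.sum_eq_one y
      simpa using this.symm
    rw [hy]
    refine Submodule.sum_mem _ fun t _ => Submodule.sum_mem _ fun r _ => ?_
    have e := congrArg (Subtype.val) ((v t).sum_repr ⟨_, hVmem t r y⟩)
    rw [← h.mul_same t r (z t) r, mul_apply_eq_comp]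
    simp only at e
    rw [← e]
    simp only [Submodule.coe_sum, Submodule.coe_smul, map_sum, map_smul]
    exact Submodule.sum_mem _ fun x _ => Submodule.smul_mem _ _
      (Submodule.subset_span ⟨⟨t, r, x⟩, rfl⟩)
  refine ⟨_, OrthonormalBasis.mk hf hspan, fun t r s x => ?_⟩
  simp only [OrthonormalBasis.coe_mk, f]
  rw [← mul_apply_eq_comp, h.mul_same]

/-! ### Complex linear and conjugate linear parts of a ring homomorphism -/

section representation

set_option linter.unusedSectionVars false
set_option linter.unnecessarySeqFocus false

variable {l : ℕ} {n : Fin l → ℕ} {R : Type*} [Ring R] [Algebra ℂ R]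

/-- The projection onto the complex linear (`true`) or conjugate linear (`false`) part of a
ring homomorphism. -/
noncomputable def linearPart (φ : MatrixSum n →+* R) : Bool → R
  -- With J = φ(i·1), this projects onto the part where J acts as i; the other case is where J acts
  -- as -i.
  | true => (1 / 2 : ℂ) • (1 - Complex.I • φ (Complex.I • 1))
  | false => (1 / 2 : ℂ) • (1 + Complex.I • φ (Complex.I • 1))

theorem map_I_mul_map_I (φ : MatrixSum n →+* R) :
    φ (Complex.I • 1) * φ (Complex.I • 1) = -1 := by
  rw [← map_mul, smul_mul_smul_comm]
  simp

theorem linearPart_mul_self (φ : MatrixSum n →+* R) (b : Bool) :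
    linearPart φ b * linearPart φ b = linearPart φ b := by
  cases b <;>
  · simp only [linearPart, smul_mul_smul_comm, mul_add, add_mul, mul_sub, sub_mul, one_mul,
      mul_one, map_I_mul_map_I, Complex.I_mul_I]
    module

theorem linearPart_mul_of_ne (φ : MatrixSum n →+* R) {b c : Bool} (h : b ≠ c) :
    linearPart φ b * linearPart φ c = 0 := by
  cases b <;> cases c <;> first | exact absurd rfl h | skip
  all_goals
    simp only [linearPart, smul_mul_smul_comm, mul_add, add_mul, mul_sub, sub_mul, one_mul,
      mul_one, map_I_mul_map_I, Complex.I_mul_I]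
    module

theorem linearPart_comm (φ : MatrixSum n →+* R) (b : Bool) (x : MatrixSum n) :
    φ x * linearPart φ b = linearPart φ b * φ x := by
  have : φ x * φ (Complex.I • 1) = φ (Complex.I • 1) * φ x := by
    rw [← map_mul, ← map_mul]; simp
  cases b <;> simp [linearPart, mul_add, add_mul, mul_sub, sub_mul, this]

theorem linearPart_add (φ : MatrixSum n →+* R) : linearPart φ true + linearPart φ false = 1 := by
  simp only [linearPart]
  module

theorem star_linearPart [StarRing R] [StarModule ℂ R]
    {φ : MatrixSum n →+* R} (hφ : ∀ x, φ (star x) = star (φ x)) (b : Bool) :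
    star (linearPart φ b) = linearPart φ b := by
  have : star (φ (Complex.I • 1)) = - φ (Complex.I • 1) := by
    rw [← hφ, ← map_neg]; simp
  cases b <;> simp [linearPart, this]

theorem map_smul_eq {φ : MatrixSum n →+* R} (hφ : ∀ t : ℝ, φ ((t : ℂ) • 1) = (t : ℂ) • 1)
    (c : ℂ) (x : MatrixSum n) :
    φ (c • x) = (c.re : ℂ) • φ x + (c.im : ℂ) • (φ (Complex.I • 1) * φ x) := by
  have e : c • x = ((c.re : ℂ) • 1) * x + ((c.im : ℂ) • 1) * ((Complex.I • 1) * x) := by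
    conv_lhs => rw [← Complex.re_add_im c]
    simp only [smul_mul_assoc, one_mul]
    module
  rw [e, map_add, map_mul, map_mul, map_mul, hφ, hφ, smul_mul_assoc, one_mul, smul_mul_assoc,
    one_mul]

theorem map_smul_mul_linearPart {φ : MatrixSum n →+* R}
    (hφ : ∀ t : ℝ, φ ((t : ℂ) • 1) = (t : ℂ) • 1) (c : ℂ) (x : MatrixSum n) (b : Bool) :
    linearPart φ b * φ (c • x) =
      (if b then c else starRingEnd ℂ c) • (linearPart φ b * φ x) := by
  rw [map_smul_eq hφ]
  conv_rhs => rw [← Complex.re_add_im c]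
  cases b <;>
  · simp only [linearPart, mul_add, mul_smul_comm, ← mul_assoc, smul_mul_assoc, add_mul, sub_mul,
      one_mul, map_I_mul_map_I, smul_add, smul_sub, map_add, map_mul, Complex.conj_ofReal,
      Complex.conj_I, if_true, neg_mul, Bool.false_eq_true, if_false]
    match_scalars <;> ring_nf <;> simp <;> ring_nf

/-- The matrix units of a ring homomorphism on a sum of matrix algebras. -/
noncomputable def matrixUnits (φ : MatrixSum n →+* R) (t : Fin l × Bool)
    (r s : Fin (n t.1)) : R :=
  linearPart φ t.2 * φ (Pi.single t.1 (Matrix.single r s 1))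

theorem matrixUnits_mul (φ : MatrixSum n →+* R) (t t' : Fin l × Bool) (r s r' s') :
    matrixUnits φ t r s * matrixUnits φ t' r' s' = linearPart φ t.2 * linearPart φ t'.2 *
      φ (Pi.single t.1 (Matrix.single r s 1) * Pi.single t'.1 (Matrix.single r' s' 1)) := by
  rw [matrixUnits, matrixUnits, map_mul, mul_assoc, ← mul_assoc (φ _), linearPart_comm]
  simp only [mul_assoc]

theorem isMatrixUnits_matrixUnits [StarRing R] [StarModule ℂ R] {φ : MatrixSum n →+* R}
    (hφ : ∀ x, φ (star x) = star (φ x)) : IsMatrixUnits (matrixUnits φ) where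
  mul_same t r s u := by
    rw [matrixUnits_mul, linearPart_mul_self, ← Pi.single_mul, Matrix.single_mul_single_same,
      one_mul, matrixUnits]
  mul_of_ne t r s s' u h := by
    rw [matrixUnits_mul, linearPart_mul_self, ← Pi.single_mul,
      Matrix.single_mul_single_of_ne _ _ _ _ h]
    simp
  mul_of_ne_block := by
    rintro ⟨j, b⟩ ⟨j', b'⟩ r s s' u h
    rw [matrixUnits_mul]
    by_cases hb : b = b'
    · have hj : j ≠ j' := fun hj => h (by rw [hj, hb])
      rw [show (Pi.single j (Matrix.single r s 1) * Pi.single j' (Matrix.single s' u 1) :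
        MatrixSum n) = 0 from ?_]
      · simp
      · ext k : 1
        by_cases hk : k = j
        · subst hk; simp [hj]
        · simp [hk]
    · rw [linearPart_mul_of_ne φ hb, zero_mul]
  star_eq t r s := by
    rw [matrixUnits, matrixUnits, star_mul, star_linearPart hφ, ← hφ, linearPart_comm,
      ← Pi.single_star, Matrix.star_eq_conjTranspose, Matrix.conjTranspose_single, star_one]
  sum_eq_one := by
    have e : (1 : MatrixSum n) = ∑ j, ∑ r, Pi.single j (Matrix.single r r 1) := by
      conv_lhs => rw [← Finset.univ_sum_single (1 : MatrixSum n)]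
      refine Finset.sum_congr rfl fun j _ => ?_
      have : (1 : Matrix (Fin (n j)) (Fin (n j)) ℂ) = ∑ r, Matrix.single r r 1 := by
        rw [← Matrix.diagonal_one]
        exact (Matrix.sum_single_eq_diagonal _).symm
      rw [Pi.one_apply, this]
      exact map_sum (AddMonoidHom.single _ j) _ _
    rw [Fintype.sum_prod_type]
    simp only [matrixUnits, Fintype.sum_bool, ← Finset.mul_sum, ← add_mul, linearPart_add,
      one_mul, ← map_sum]
    rw [← e, map_one]

/-- The relation x eₛᵤ = ∑ᵣ xᵣₛ eᵣᵤ, with coefficients conjugated on the conjugate linear part. -/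
theorem map_mul_matrixUnits {φ : MatrixSum n →+* R}
    (hφ : ∀ t : ℝ, φ ((t : ℂ) • 1) = (t : ℂ) • 1) (x : MatrixSum n) (t : Fin l × Bool) (s u) :
    φ x * matrixUnits φ t s u =
      ∑ r, (if t.2 then x t.1 r s else starRingEnd ℂ (x t.1 r s)) • matrixUnits φ t r u := by
  have e : x * Pi.single t.1 (Matrix.single s u 1) =
      ∑ r, x t.1 r s • (Pi.single t.1 (Matrix.single r u (1 : ℂ)) : MatrixSum n) := by
    ext k a b
    by_cases hk : k = t.1
    · subst hk
      rw [Finset.sum_apply, Matrix.sum_apply]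
      simp only [Pi.mul_apply, Pi.single_eq_same, Pi.smul_apply, Matrix.smul_apply,
        Matrix.single_apply, smul_eq_mul, Matrix.mul_apply]
      by_cases hub : u = b <;> simp [hub]
    · simp [hk]
  rw [matrixUnits, ← mul_assoc, linearPart_comm, mul_assoc, ← map_mul, e, map_sum, Finset.mul_sum]
  exact Finset.sum_congr rfl fun r _ => map_smul_mul_linearPart hφ _ _ _

end representation

/-! ### The block diagonal model as a `*`-homomorphism -/

section copies

variable {l : ℕ} {n : Fin l → ℕ} (p q : Fin l → ℕ)

theorem copies_mul (x y : MatrixSum n) : copies p q (x * y) = copies p q x * copies p q y := by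
  simp only [copies, ← Matrix.blockDiagonal'_mul, Matrix.fromBlocks_multiply, Matrix.mul_zero,
    Matrix.zero_mul, add_zero, zero_add, ← Matrix.blockDiagonal_mul, Pi.mul_apply, Matrix.map_mul]

theorem copies_one : copies p q (1 : MatrixSum n) = 1 := by
  have e : ∀ k d : ℕ, (Matrix.blockDiagonal fun _ : Fin d => (1 : Matrix (Fin k) (Fin k) ℂ)) = 1 :=
    fun _ _ => Matrix.blockDiagonal_one
  simp only [copies, Pi.one_apply, Matrix.map_one _ (map_zero _) (map_one _), e,
    Matrix.fromBlocks_one]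
  exact Matrix.blockDiagonal'_one

theorem copies_add (x y : MatrixSum n) : copies p q (x + y) = copies p q x + copies p q y := by
  have e : ∀ (k d : ℕ) (a b : Matrix (Fin k) (Fin k) ℂ),
      (Matrix.blockDiagonal fun _ : Fin d => a + b) =
        (Matrix.blockDiagonal fun _ : Fin d => a) + Matrix.blockDiagonal fun _ : Fin d => b :=
    fun _ _ a b => Matrix.blockDiagonal_add (fun _ => a) (fun _ => b)
  rw [copies, copies, copies, ← Matrix.blockDiagonal'_add]
  congr 1
  ext1 j
  simp only [Pi.add_apply, Matrix.map_add _ (fun a b => map_add (starRingEnd ℂ) a b), e,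
    Matrix.fromBlocks_add, add_zero]

theorem copies_star (x : MatrixSum n) : copies p q (star x) = star (copies p q x) := by
  simp only [copies, Matrix.star_eq_conjTranspose, Matrix.blockDiagonal'_conjTranspose,
    Matrix.fromBlocks_conjTranspose, Matrix.blockDiagonal_conjTranspose, Matrix.conjTranspose_zero,
    Pi.star_apply]
  rfl

theorem copies_real_smul (t : ℝ) (x : MatrixSum n) :
    copies p q ((t : ℂ) • x) = (t : ℂ) • copies p q x := by
  ext ⟨j, a⟩ ⟨j', b⟩
  rw [Matrix.smul_apply, copies, copies, Matrix.blockDiagonal'_apply, Matrix.blockDiagonal'_apply]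
  split_ifs with h
  · dsimp only at h
    subst h
    rcases a with ⟨a, a'⟩ | ⟨a, a'⟩ <;> rcases b with ⟨b, b'⟩ | ⟨b, b'⟩ <;>
      simp [Matrix.blockDiagonal_apply]
  · simp

theorem eq_zero_of_copies_eq_zero {x : MatrixSum n} (h : copies p q x = 0) {j : Fin l}
    (hj : 0 < p j + q j) : x j = 0 := by
  ext r s
  rcases Nat.eq_zero_or_pos (p j) with hp | hp
  · have := congrFun (congrFun h ⟨j, Sum.inr (r, ⟨0, by omega⟩)⟩) ⟨j, Sum.inr (s, ⟨0, by omega⟩)⟩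
    simpa [copies, Matrix.blockDiagonal'_apply, Matrix.blockDiagonal_apply] using this
  · have := congrFun (congrFun h ⟨j, Sum.inl (r, ⟨0, hp⟩)⟩) ⟨j, Sum.inl (s, ⟨0, hp⟩)⟩
    simpa [copies, Matrix.blockDiagonal'_apply, Matrix.blockDiagonal_apply] using this

theorem card_copyIndex : Fintype.card (CopyIndex n p q) = ∑ j, (p j + q j) * n j := by
  simp only [CopyIndex, Fintype.card_sigma, Fintype.card_sum, Fintype.card_prod, Fintype.card_fin]
  exact Finset.sum_congr rfl fun j _ => by ring

variable {p q}

/-- The `*`-homomorphism `α ↦ U (⊕ⱼ (αⱼ^{⊕ pⱼ} ⊕ ᾱⱼ^{⊕ qⱼ})) Uᴴ`. -/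
noncomputable def copiesHom {m : ℕ} (e : CopyIndex n p q ≃ Fin m)
    (U : Matrix.unitaryGroup (Fin m) ℂ) : MatrixSum n →+* Matrix (Fin m) (Fin m) ℂ where
  toFun x := (U : Matrix (Fin m) (Fin m) ℂ) * Matrix.reindex e e (copies p q x) *
    (U : Matrix (Fin m) (Fin m) ℂ)ᴴ
  map_one' := by
    rw [copies_one, Matrix.reindex_apply, Matrix.submatrix_one_equiv, mul_one]
    exact Matrix.mem_unitaryGroup_iff.1 U.2
  map_mul' x y := by
    have h : (U : Matrix (Fin m) (Fin m) ℂ)ᴴ * U = 1 := Matrix.mem_unitaryGroup_iff'.1 U.2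
    rw [copies_mul]
    simp only [Matrix.reindex_apply, ← Matrix.submatrix_mul_equiv _ _ e.symm e.symm e.symm]
    simp only [← mul_assoc]
    rw [mul_assoc (_ * _) _ (U : Matrix (Fin m) (Fin m) ℂ), h, mul_one]
  map_zero' := by
    have : copies p q (0 : MatrixSum n) = 0 := by
      simpa using copies_real_smul p q 0 (0 : MatrixSum n)
    simp [this]
  map_add' x y := by
    simp only [copies_add, Matrix.reindex_apply, Matrix.submatrix_add, Pi.add_apply, mul_add,
      add_mul]

variable {m : ℕ} (e : CopyIndex n p q ≃ Fin m) (U : Matrix.unitaryGroup (Fin m) ℂ)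

theorem copiesHom_apply (x : MatrixSum n) : copiesHom e U x =
    (U : Matrix (Fin m) (Fin m) ℂ) * Matrix.reindex e e (copies p q x) *
    (U : Matrix (Fin m) (Fin m) ℂ)ᴴ := rfl

theorem copiesHom_star (x : MatrixSum n) : copiesHom e U (star x) = star (copiesHom e U x) := by
  rw [copiesHom_apply, copiesHom_apply, copies_star]
  simp only [Matrix.star_eq_conjTranspose, Matrix.conjTranspose_mul, mul_assoc,
    Matrix.conjTranspose_conjTranspose, Matrix.conjTranspose_reindex]

theorem copiesHom_real_smul (t : ℝ) (x : MatrixSum n) :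
    copiesHom e U ((t : ℂ) • x) = (t : ℂ) • copiesHom e U x := by
  rw [copiesHom_apply, copiesHom_apply, copies_real_smul]
  simp [Matrix.submatrix_smul]

theorem copies_eq_zero_of_copiesHom {x : MatrixSum n} (h : copiesHom e U x = 0) :
    copies p q x = 0 := by
  have hU : (U : Matrix (Fin m) (Fin m) ℂ)ᴴ * U = 1 := Matrix.mem_unitaryGroup_iff'.1 U.2
  have h2 := congrArg (fun z => (U : Matrix (Fin m) (Fin m) ℂ)ᴴ * z * U) h
  simp only [copiesHom_apply, ← mul_assoc, hU, one_mul] at h2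
  rw [mul_assoc, hU] at h2
  apply (Matrix.reindex e e).injective
  simpa using h2

end copies

/-! ### Normal form of `*`-homomorphisms into a matrix algebra -/

section representation

variable {l : ℕ} {n : Fin l → ℕ}

/-- Pairs of a summand and a linearity type, and copies of the summand, index the same basis. -/
def copyIndexEquiv (d : Fin l × Bool → ℕ) :
    (Σ t : Fin l × Bool, Fin (n t.1) × Fin (d t)) ≃
      CopyIndex n (fun j => d (j, true)) (fun j => d (j, false)) where
  toFun
    | ⟨(j, true), a⟩ => ⟨j, Sum.inl a⟩
    | ⟨(j, false), a⟩ => ⟨j, Sum.inr a⟩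
  invFun
    | ⟨j, Sum.inl a⟩ => ⟨(j, true), a⟩
    | ⟨j, Sum.inr a⟩ => ⟨(j, false), a⟩
  left_inv := by rintro ⟨⟨j, _ | _⟩, a⟩ <;> rfl
  right_inv := by rintro ⟨j, a | a⟩ <;> rfl

/-- A real-homogeneous `*`-homomorphism from a sum of matrix algebras to the operators on a
finite-dimensional Hilbert space is given by copies of the summands and their conjugates. -/
theorem exists_orthonormalBasis_copies {H : Type*} [NormedAddCommGroup H] [InnerProductSpace ℂ H]
    [FiniteDimensional ℂ H] (hn : ∀ j, 0 < n j) {φ : MatrixSum n →+* (H →L[ℂ] H)}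
    (hs : ∀ x, φ (star x) = star (φ x)) (hr : ∀ t : ℝ, φ ((t : ℂ) • 1) = (t : ℂ) • 1) :
    ∃ (p q : Fin l → ℕ) (b : OrthonormalBasis (CopyIndex n p q) ℂ H),
      ∀ x κ, φ x (b κ) = ∑ κ', copies p q x κ' κ • b κ' := by
  obtain ⟨d, b, hb⟩ := (isMatrixUnits_matrixUnits hs).exists_orthonormalBasis
    fun t : Fin l × Bool => hn t.1
  have key : ∀ x (t : Fin l × Bool) s a, φ x (b ⟨t, (s, a)⟩) =
      ∑ r, (if t.2 then x t.1 r s else starRingEnd ℂ (x t.1 r s)) • b ⟨t, (r, a)⟩ := by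
    intro x t s a
    -- The diagonal unit (s, s) fixes this basis vector, so φ x may be applied to the unit instead.
    have h1 := DFunLike.congr_fun (map_mul_matrixUnits hr x t s s) (b ⟨t, (s, a)⟩)
    rw [mul_apply_eq_comp, hb] at h1
    simpa only [sum_apply, smul_apply, hb] using h1
  refine ⟨_, _, b.reindex (copyIndexEquiv d), ?_⟩
  rintro x ⟨j, ⟨s, a⟩ | ⟨s, a⟩⟩
  · have := key x (j, true) s a
    simp only [OrthonormalBasis.reindex_apply]
    refine this.trans ?_
    rw [Fintype.sum_sigma, Finset.sum_eq_single j]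
    · simp [Fintype.sum_sum_type, Fintype.sum_prod_type, copies, Matrix.blockDiagonal'_apply,
        Matrix.blockDiagonal_apply, copyIndexEquiv]
    · intro j' _ hj
      simp [copies, Matrix.blockDiagonal'_apply, hj]
    · simp
  · have := key x (j, false) s a
    simp only [OrthonormalBasis.reindex_apply]
    refine this.trans ?_
    rw [Fintype.sum_sigma, Finset.sum_eq_single j]
    · simp [Fintype.sum_sum_type, Fintype.sum_prod_type, copies, Matrix.blockDiagonal'_apply,
        Matrix.blockDiagonal_apply, copyIndexEquiv]
    · intro j' _ hj
      simp [copies, Matrix.blockDiagonal'_apply, hj]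
    · simp

theorem exists_eq_copiesHom {m : ℕ} (hn : ∀ j, 0 < n j)
    {φ : MatrixSum n →+* Matrix (Fin m) (Fin m) ℂ}
    (hs : ∀ x, φ (star x) = star (φ x)) (hr : ∀ t : ℝ, φ ((t : ℂ) • 1) = (t : ℂ) • 1) :
    ∃ (p q : Fin l → ℕ) (e : CopyIndex n p q ≃ Fin m) (U : Matrix.unitaryGroup (Fin m) ℂ),
      φ = copiesHom e U := by
  let T := Matrix.toEuclideanCLM (𝕜 := ℂ) (n := Fin m)
  obtain ⟨p, q, b, hb⟩ := exists_orthonormalBasis_copies hn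
    (φ := (RingHomClass.toRingHom T).comp φ)
    (fun x => by
      change T (φ (star x)) = star (T (φ x))
      rw [hs, map_star])
    (fun t => by
      change T (φ _) = _
      rw [hr, map_smul, map_one])
  have hcard : Fintype.card (CopyIndex n p q) = Fintype.card (Fin m) := by
    rw [← Module.finrank_eq_card_basis b.toBasis]; simp
  let e : CopyIndex n p q ≃ Fin m := Fintype.equivOfCardEq hcard
  let b' := b.reindex e
  -- The columns of `U` are the adapted basis vectors.
  let U : Matrix (Fin m) (Fin m) ℂ :=
    (EuclideanSpace.basisFun (Fin m) ℂ).toBasis.toMatrix b'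
  have hU : U ∈ Matrix.unitaryGroup (Fin m) ℂ :=
    OrthonormalBasis.toMatrix_orthonormalBasis_mem_unitary _ _
  refine ⟨p, q, e, ⟨U, hU⟩, RingHom.ext fun x => ?_⟩
  have hU' : U * Uᴴ = 1 := Matrix.mem_unitaryGroup_iff.1 hU
  have main : φ x * U = U * Matrix.reindex e e (copies p q x) := by
    ext a c
    have h1 := hb x (e.symm c)
    have h2 := congrArg (fun v : EuclideanSpace ℂ (Fin m) => v a) h1
    have h3 : (b (e.symm c)) = b' c := by simp [b']
    have e1 : (φ x * U) a c = (T (φ x) (b (e.symm c))) a := by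
      rw [h3]
      simp [T, Matrix.mul_apply, Matrix.mulVec, dotProduct, U, Module.Basis.toMatrix_apply]
    rw [e1]
    refine h2.trans ?_
    rw [Matrix.mul_apply, ← e.sum_comp]
    simp [U, Module.Basis.toMatrix_apply, b', mul_comm]
  rw [copiesHom_apply, ← main, mul_assoc, hU', mul_one]

end representation

/-! ### Injectivity and spectra -/

/-- In an Artinian ring units are exactly the regular elements, and an injective homomorphism
reflects regularity. -/
theorem isUnit_map_iff_of_injective {R S : Type*} [Ring R] [IsArtinianRing R] [Ring S]
    (f : R →+* S) (hf : Function.Injective f) (x : R) : IsUnit (f x) ↔ IsUnit x := by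
  refine ⟨fun h => ?_, fun h => h.map f⟩
  refine IsArtinianRing.isUnit_iff_isRegular.2 ⟨fun y z hyz => hf ?_, fun y z hyz => hf ?_⟩
  · exact h.mul_left_cancel (by simpa using congrArg f hyz)
  · exact h.mul_right_cancel (by simpa using congrArg f hyz)

/-- An injective real-linear `*`-homomorphism preserves the spectra of self-adjoint elements. -/
theorem IsSelfAdjoint.spectrum_map_eq {𝒜 ℬ : Type*} [CStarAlgebra 𝒜] [CStarAlgebra ℬ]
    [FiniteDimensional ℂ 𝒜] {f : 𝒜 →+* ℬ} (hf : Function.Injective f)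
    (hs : ∀ x, f (star x) = star (f x))
    (hr : ∀ t : ℝ, f (algebraMap ℝ 𝒜 t) = algebraMap ℝ ℬ t) {a : 𝒜} (ha : IsSelfAdjoint a) :
    spectrum ℂ (f a) = spectrum ℂ a := by
  have : IsArtinianRing 𝒜 := IsArtinianRing.of_finite ℂ 𝒜
  have hfa : IsSelfAdjoint (f a) := by rw [IsSelfAdjoint, ← hs, ha.star_eq]
  -- `f` need not be complex linear, but self-adjoint spectra are real, so real scalars suffice.
  rw [← ha.spectrumRestricts.algebraMap_image, ← hfa.spectrumRestricts.algebraMap_image]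
  congr 1
  ext t
  rw [spectrum.mem_iff, spectrum.mem_iff, ← hr, ← map_sub, isUnit_map_iff_of_injective f hf]

theorem IsEncoding.eq_zero_of_map_eq_zero {𝒜 ℬ : Type*} [CStarAlgebra 𝒜] [CStarAlgebra ℬ]
    {A : SpecialJBAlgebra 𝒜} {B : SpecialJBAlgebra ℬ} {γ : A.Elt → B.Elt} (h : IsEncoding γ)
    {a : A.Elt} (ha : (γ a : ℬ) = 0) : (a : 𝒜) = 0 := by
  apply CFC.eq_zero_of_spectrum_subset_zero (R := ℝ) _ ?_ (A.isSelfAdjoint' a.2)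
  rw [← h.spectrum_real_eq, ha]
  intro x hx
  by_contra hne
  apply hx
  simpa [spectrum.mem_resolventSet_iff] using (IsUnit.mk0 x hne).map (algebraMap ℝ ℬ)

theorem copies_single_eq_zero {l : ℕ} {n : Fin l → ℕ} {p q : Fin l → ℕ} {j : Fin l}
    (hj : p j + q j = 0) (z : Matrix (Fin (n j)) (Fin (n j)) ℂ) :
    copies p q (Pi.single j z : MatrixSum n) = 0 := by
  have hp : IsEmpty (Fin (p j)) := by rw [show p j = 0 by omega]; infer_instance
  have hq : IsEmpty (Fin (q j)) := by rw [show q j = 0 by omega]; infer_instance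
  ext ⟨i, a⟩ ⟨i', b⟩
  by_cases hi : i = j
  · subst hi
    rcases a with ⟨_, a⟩ | ⟨_, a⟩ <;> exact isEmptyElim a
  · rw [copies, Matrix.blockDiagonal'_apply]
    split_ifs with h
    · dsimp only at h
      subst h
      have e : ∀ k d : ℕ, (Matrix.blockDiagonal fun _ : Fin d =>
          (0 : Matrix (Fin k) (Fin k) ℂ)) = 0 := fun _ _ => Matrix.blockDiagonal_zero
      simp [hi, e]
    · rfl

/-! ### Transport along the decompositions of 𝒜 and ℬ -/

section decomposition

variable {𝒜 ℬ : Type*} [CStarAlgebra 𝒜] [CStarAlgebra ℬ] {l k : ℕ} {n : Fin l → ℕ}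
  {m : Fin k → ℕ} {Φ : 𝒜 ≃⋆ₐ[ℂ] MatrixSum n} {Ψ : ℬ ≃⋆ₐ[ℂ] MatrixSum m}

theorem StarAlgEquiv.finiteDimensional_of_matrixSum (Φ : 𝒜 ≃⋆ₐ[ℂ] MatrixSum n) :
    FiniteDimensional ℂ 𝒜 :=
  Module.Finite.of_surjective (Φ.symm.toAlgEquiv.toLinearMap : MatrixSum n →ₗ[ℂ] 𝒜)
    Φ.symm.surjective

theorem hasCopiesForm_iff {p q : Fin k → Fin l → ℕ} {Γ : 𝒜 → ℬ} :
    HasCopiesForm Φ Ψ p q Γ ↔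
      ∃ (e : ∀ i, CopyIndex n (p i) (q i) ≃ Fin (m i))
        (U : ∀ i, Matrix.unitaryGroup (Fin (m i)) ℂ),
        ∀ x i, Ψ (Γ x) i = copiesHom (e i) (U i) (Φ x) :=
  ⟨fun ⟨e, U, hU, h⟩ => ⟨e, fun i => ⟨U i, hU i⟩, h⟩,
    fun ⟨e, U, h⟩ => ⟨e, fun i => U i, fun i => (U i).2, h⟩⟩

theorem exists_hasCopiesForm (hn : ∀ j, 0 < n j) {Γ : 𝒜 →+* ℬ}
    (hs : ∀ x, Γ (star x) = star (Γ x)) (hr : ∀ t : ℝ, Γ ((t : ℂ) • 1) = (t : ℂ) • 1) :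
    ∃ p q : Fin k → Fin l → ℕ,
      (∀ i, ∑ j, (p i j + q i j) * n j = m i) ∧ HasCopiesForm Φ Ψ p q Γ := by
  let φ : ∀ i, MatrixSum n →+* Matrix (Fin (m i)) (Fin (m i)) ℂ := fun i =>
    (Pi.evalRingHom _ i).comp ((RingHomClass.toRingHom Ψ).comp
      (Γ.comp (RingHomClass.toRingHom Φ.symm)))
  have hφ : ∀ i x, φ i x = Ψ (Γ (Φ.symm x)) i := fun _ _ => rfl
  choose p q e U h using fun i => exists_eq_copiesHom hn (φ := φ i)
    (fun x => by rw [hφ, hφ, map_star, hs, map_star]; rfl)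
    (fun t => by rw [hφ, map_smul, map_one, hr, map_smul, map_one]; rfl)
  refine ⟨p, q, fun i => ?_, hasCopiesForm_iff.2 ⟨e, U, fun x i => ?_⟩⟩
  · rw [← card_copyIndex, Fintype.card_congr (e i), Fintype.card_fin]
  · rw [← h, hφ, StarAlgEquiv.symm_apply_apply]

theorem exists_extension (Φ : 𝒜 ≃⋆ₐ[ℂ] MatrixSum n) {B : SpecialJBAlgebra ℬ}
    {γ : (SpecialJBAlgebra.full 𝒜).Elt → B.Elt} (h : IsEncoding γ) :
    ∃ Γ : 𝒜 →+* ℬ, (∀ a : (SpecialJBAlgebra.full 𝒜).Elt, Γ a = γ a) ∧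
      ∀ x, Γ (star x) = star (Γ x) := by
  have := Φ.finiteDimensional_of_matrixSum
  obtain ⟨θ, hθ, hs, hm⟩ := h.exists_jordanHom
  have h1 : θ 1 = 1 := by
    rw [← h.map_one ⟨1, IsSelfAdjoint.one 𝒜⟩ rfl]
    exact hθ ⟨1, IsSelfAdjoint.one 𝒜⟩
  let θ' : MatrixSum n →ₗ[ℂ] ℬ := θ ∘ₗ (Φ.symm.toAlgEquiv.toLinearMap : MatrixSum n →ₗ[ℂ] 𝒜)
  have hθ' : ∀ x, θ' x = θ (Φ.symm x) := fun _ => rfl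
  have hj : IsJordanStarHom θ' :=
    { map_mul_self := fun x => by rw [hθ', hθ', map_mul, hm]
      map_star := fun x => by rw [hθ', hθ', map_star, hs] }
  obtain ⟨Γ, hΓs, hΓ⟩ := hj.exists_ringHom (by rw [hθ', map_one, h1])
  refine ⟨Γ.comp (RingHomClass.toRingHom Φ), fun a => ?_, fun x => ?_⟩
  · change Γ (Φ a) = _
    rw [hΓ, hθ', StarAlgEquiv.symm_apply_apply, hθ]
    have ha : IsSelfAdjoint (a : 𝒜) := a.2
    rw [IsSelfAdjoint, ← map_star, ha.star_eq]
  · change Γ (Φ (star x)) = star (Γ (Φ x))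
    rw [map_star, hΓs]

/-- The elements on which Γ commutes with the involution form a subring, so generators suffice. -/
theorem map_star_of_map_star_single (Φ : 𝒜 ≃⋆ₐ[ℂ] MatrixSum n) {Γ : 𝒜 →+* ℬ}
    (hsa : ∀ a, IsSelfAdjoint a → IsSelfAdjoint (Γ a))
    (h1 : ∀ j, n j = 1 → ∀ z : Matrix (Fin (n j)) (Fin (n j)) ℂ,
      Γ (star (Φ.symm (Pi.single j z))) = star (Γ (Φ.symm (Pi.single j z)))) (x : 𝒜) :
    Γ (star x) = star (Γ x) := by
  let S : Subring (MatrixSum n) :=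
    { carrier := {x | Γ (star (Φ.symm x)) = star (Γ (Φ.symm x))}
      mul_mem' := fun {a b} ha hb => by
        simp only [Set.mem_ofPred_eq] at ha hb ⊢
        simp only [map_mul, star_mul, ha, hb]
      one_mem' := by simp
      add_mem' := fun {a b} ha hb => by
        simp only [Set.mem_ofPred_eq] at ha hb ⊢
        simp only [map_add, star_add, ha, hb]
      zero_mem' := by simp
      neg_mem' := fun {a} ha => by
        simp only [Set.mem_ofPred_eq] at ha ⊢
        simp only [map_neg, star_neg, ha] }
  have hS : S = ⊤ := MatrixSum.subring_eq_top S (fun x hx => by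
    have hx' : IsSelfAdjoint (Φ.symm x) := by rw [IsSelfAdjoint, ← map_star, hx.star_eq]
    change Γ (star (Φ.symm x)) = star (Γ (Φ.symm x))
    rw [hx'.star_eq, (hsa _ hx').star_eq]) h1
  have hx : Φ x ∈ S := hS ▸ Subring.mem_top _
  change Γ (star (Φ.symm (Φ x))) = star (Γ (Φ.symm (Φ x))) at hx
  rwa [StarAlgEquiv.symm_apply_apply] at hx

theorem eq_of_eq_on_selfAdjoint (Φ : 𝒜 ≃⋆ₐ[ℂ] MatrixSum n) (hn : ∀ j, 2 ≤ n j) {Γ Γ' : 𝒜 →+* ℬ}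
    (h : ∀ a, IsSelfAdjoint a → Γ a = Γ' a) : Γ = Γ' := by
  have hS := MatrixSum.subring_eq_top
    ((Γ.comp (RingHomClass.toRingHom Φ.symm)).eqLocus (Γ'.comp (RingHomClass.toRingHom Φ.symm)))
    (fun x hx => h (Φ.symm x) (by rw [IsSelfAdjoint, ← map_star, hx.star_eq]))
    (fun j hj => absurd (hn j) (by omega))
  ext x
  have hx : Γ (Φ.symm (Φ x)) = Γ' (Φ.symm (Φ x)) :=
    (hS.symm ▸ Subring.mem_top (Φ x) : Φ x ∈ RingHom.eqLocus
      (Γ.comp (RingHomClass.toRingHom Φ.symm)) (Γ'.comp (RingHomClass.toRingHom Φ.symm)))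
  rwa [StarAlgEquiv.symm_apply_apply] at hx

theorem exists_map_hasCopiesForm {p q : Fin k → Fin l → ℕ}
    (hm : ∀ i, ∑ j, (p i j + q i j) * n j = m i) :
    ∃ Γ : 𝒜 → ℬ, HasCopiesForm Φ Ψ p q Γ := by
  let e : ∀ i, CopyIndex n (p i) (q i) ≃ Fin (m i) := fun i =>
    Fintype.equivFinOfCardEq (by rw [card_copyIndex, hm])
  refine ⟨fun x => Ψ.symm fun i => copiesHom (e i) 1 (Φ x),
    hasCopiesForm_iff.2 ⟨e, fun _ => 1, fun x i => ?_⟩⟩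
  rw [StarAlgEquiv.apply_symm_apply]

theorem HasCopiesForm.exists_ringHom {p q : Fin k → Fin l → ℕ} {Γ : 𝒜 → ℬ}
    (h : HasCopiesForm Φ Ψ p q Γ) (hpq : ∀ j, ∃ i, 0 < p i j + q i j) :
    ∃ Γ' : 𝒜 →+* ℬ, (∀ x, Γ' x = Γ x) ∧ (∀ x, Γ' (star x) = star (Γ' x)) ∧
      (∀ (t : ℝ) x, Γ' (t • x) = t • Γ' x) ∧ Function.Injective Γ' := by
  obtain ⟨e, U, h⟩ := hasCopiesForm_iff.1 h
  let Γ' : 𝒜 →+* ℬ := (RingHomClass.toRingHom Ψ.symm).comp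
    ((RingHom.pi fun i => copiesHom (e i) (U i)).comp (RingHomClass.toRingHom Φ))
  have hΓ' : ∀ x i, Ψ (Γ' x) i = copiesHom (e i) (U i) (Φ x) := fun x i => by
    change Ψ (Ψ.symm fun i => copiesHom (e i) (U i) (Φ x)) i = _
    rw [StarAlgEquiv.apply_symm_apply]
  refine ⟨Γ', fun x => ?_, fun x => ?_, fun t x => ?_, ?_⟩
  · exact EquivLike.injective Ψ (funext fun i => by rw [hΓ', h])
  · refine EquivLike.injective Ψ (funext fun i => ?_)
    rw [hΓ', map_star Φ, map_star Ψ, copiesHom_star, Pi.star_apply, hΓ']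
  · refine EquivLike.injective Ψ (funext fun i => ?_)
    rw [← Complex.coe_smul, ← Complex.coe_smul, hΓ', map_smul Φ, map_smul Ψ, copiesHom_real_smul,
      Pi.smul_apply, hΓ']
  · refine (injective_iff_map_eq_zero Γ').2 fun x hx => ?_
    apply EquivLike.injective Φ
    rw [map_zero]
    ext1 j
    obtain ⟨i, hi⟩ := hpq j
    refine eq_zero_of_copies_eq_zero (p i) (q i) (copies_eq_zero_of_copiesHom (e i) (U i) ?_) hi
    rw [← hΓ', hx, map_zero, Pi.zero_apply]

end decomposition

/-! ### Assembly -/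

theorem mainTheorem2 {𝒜 ℬ : Type*} [CStarAlgebra 𝒜] [CStarAlgebra ℬ]
    {l k : ℕ} (n : Fin l → ℕ) (m : Fin k → ℕ)
    (hn : ∀ j, 0 < n j) (hm : ∀ i, 0 < m i)
    (Φ : 𝒜 ≃⋆ₐ[ℂ] MatrixSum n) (Ψ : ℬ ≃⋆ₐ[ℂ] MatrixSum m) :
    (∀ (A : SpecialJBAlgebra 𝒜) (B : SpecialJBAlgebra ℬ) (γ : A.Elt → B.Elt), IsEncoding γ →
      -- form of the extended encodings
      (∀ Γ : 𝒜 →+* ℬ, (∀ a : A.Elt, Γ a = γ a) → (∀ x, Γ (star x) = star (Γ x)) →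
        ∃ p q : Fin k → Fin l → ℕ,
          (∀ i, ∑ j, (p i j + q i j) * n j = m i) ∧
          HasCopiesForm Φ Ψ p q Γ ∧
          (A = SpecialJBAlgebra.full 𝒜 → ∀ j, ∃ i, 0 < p i j + q i j)) ∧
      -- existence, compatibility with the involution, and uniqueness of the extension
      (A = SpecialJBAlgebra.full 𝒜 →
        (∃ Γ : 𝒜 →+* ℬ, (∀ a : A.Elt, Γ a = γ a) ∧ ∀ x, Γ (star x) = star (Γ x)) ∧
        (∀ Γ : 𝒜 →+* ℬ, (∀ a : A.Elt, Γ a = γ a) →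
          (∀ j, n j = 1 → ∀ z : Matrix (Fin (n j)) (Fin (n j)) ℂ,
            Γ (star (Φ.symm (Pi.single j z))) = star (Γ (Φ.symm (Pi.single j z)))) →
          ∀ x, Γ (star x) = star (Γ x)) ∧
        ((∀ j, 2 ≤ n j) → ∃! Γ : 𝒜 →+* ℬ, ∀ a : A.Elt, Γ a = γ a))) ∧
    -- conversely, all multiplicities occur, and every map of this form is an extended encoding
    (∀ p q : Fin k → Fin l → ℕ,
      (∀ i, ∑ j, (p i j + q i j) * n j = m i) → (∀ j, ∃ i, 0 < p i j + q i j) →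
      (∃ Γ : 𝒜 → ℬ, HasCopiesForm Φ Ψ p q Γ) ∧
      ∀ Γ : 𝒜 → ℬ, HasCopiesForm Φ Ψ p q Γ →
        ∃ Γ' : 𝒜 →+* ℬ, (∀ x, Γ' x = Γ x) ∧ (∀ x, Γ' (star x) = star (Γ' x)) ∧
          ∃ γ : (SpecialJBAlgebra.full 𝒜).Elt → (SpecialJBAlgebra.full ℬ).Elt,
            IsEncoding γ ∧ ∀ a, (γ a : ℬ) = Γ a) := by
  refine ⟨fun A B γ hγ => ⟨fun Γ hΓ hs => ?_, ?_⟩, fun p q hm' hpq => ⟨?_, fun Γ h => ?_⟩⟩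
  -- Real homogeneity of Γ is inherited from γ at the real multiples of 1, which lie in every `A`.
  · have hr : ∀ t : ℝ, Γ ((t : ℂ) • 1) = (t : ℂ) • 1 := fun t => by
      let o : A.Elt := ⟨1, A.one_mem'⟩
      have h := hΓ (t • o)
      rw [hγ.map_smul] at h
      rw [Complex.coe_smul, Complex.coe_smul, ← hγ.map_one o rfl]
      exact h
    obtain ⟨p, q, hpq, hform⟩ := exists_hasCopiesForm (Φ := Φ) (Ψ := Ψ) hn hs hr
    refine ⟨p, q, hpq, hform, ?_⟩
    rintro rfl j
    by_contra! hj
    obtain ⟨e, U, h⟩ := hasCopiesForm_iff.1 hform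
    have hsa : IsSelfAdjoint (Φ.symm (Pi.single j 1)) := by
      rw [IsSelfAdjoint, ← map_star, ← Pi.single_star, star_one]
    -- A summand occurring nowhere would have its unit killed, but γ sends no nonzero element to 0.
    have hzero : Γ (Φ.symm (Pi.single j 1)) = 0 := by
      refine EquivLike.injective Ψ (funext fun i => ?_)
      rw [h, StarAlgEquiv.apply_symm_apply, copiesHom_apply,
        copies_single_eq_zero (Nat.le_zero.1 (hj i))]
      simp
    have h0 := hγ.eq_zero_of_map_eq_zero (a := ⟨_, hsa⟩) (by rw [← hΓ]; exact hzero)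
    have h1 : (Pi.single j 1 : MatrixSum n) = 0 := by
      apply EquivLike.injective Φ.symm
      rw [map_zero]
      exact h0
    have h2 := congrFun (congrFun (congrFun h1 j) ⟨0, hn j⟩) ⟨0, hn j⟩
    simp at h2
  · rintro rfl
    have hex := exists_extension Φ hγ
    refine ⟨hex, fun Γ hΓ h1 => map_star_of_map_star_single Φ (fun a ha => ?_) h1, fun h2 => ?_⟩
    · rw [hΓ ⟨a, ha⟩]
      exact B.isSelfAdjoint' (γ _).2
    · obtain ⟨Γ, hΓ, -⟩ := hex
      refine ⟨Γ, hΓ, fun Γ' hΓ' => eq_of_eq_on_selfAdjoint Φ h2 fun a ha => ?_⟩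
      exact (hΓ' ⟨a, ha⟩).trans (hΓ ⟨a, ha⟩).symm
  · exact exists_map_hasCopiesForm hm'
  · have := Φ.finiteDimensional_of_matrixSum
    obtain ⟨Γ', hΓ', hs, hr, hinj⟩ := h.exists_ringHom hpq
    refine ⟨Γ', hΓ', hs, fun a => ⟨Γ' a, ?_⟩, ⟨fun a => ?_, fun a b t _ _ => ?_⟩,
      fun a => hΓ' a⟩
    · have ha : IsSelfAdjoint (a : 𝒜) := a.2
      change star (Γ' a) = Γ' a
      rw [← hs, ha.star_eq]
    · refine IsSelfAdjoint.spectrum_map_eq hinj hs (fun t => ?_) a.2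
      rw [Algebra.algebraMap_eq_smul_one, Algebra.algebraMap_eq_smul_one, hr, map_one]
    · apply Subtype.ext
      change Γ' (t • (a : 𝒜) + (1 - t) • (b : 𝒜)) = t • Γ' a + (1 - t) • Γ' b
      rw [map_add, hr, hr]
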